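/- Let $K$ be a field complete with respect to a non-trivial non-Archimedean valuation $v\colon K\to\mathbb R\cup\{+\infty\}$ that is discrete, i.e. the maximal ideal $\mathfrak m$ of the valuation ring $R=\{a\in K: v(a)\ge 0\}$ is generated by one element $\pi$. Let $k=R/\mathfrak m$ be the residue field. For $n\ge 0$ let $$\mathcal R_n=R\langle x_1,\dots,x_n\rangle=\Bigl\{\sum_{J\in\mathbb N^n}a_Jx^J : a_J\in R,\ v(a_J)\to+\infty \text{ as } |J|\to+\infty\Bigr\}.$$ Reducing coefficients modulo $\mathfrak m$ gives a ring homomorphism $\mathcal R_n\to k[x]=k[x_1,\dots,x_n]$; write $\overline{I}\subseteq k[x]$ for the image of an ideal $I\subseteq\mathcal R_n$. Put $$I^{\mathrm{ec}}=\{f\in\mathcal R_n : af\in I \text{ for some } a\in R\setminus\{0\}\},\qquad I_l=\{g\in\mathcal R_n : \pi^l g\in I\}\quad(l\ge 0).$$ Here $\dim$ denotes Krull dimension, with $\dim 0=-\infty$. Let $r\ge 0$ and let $I\subseteq\mathcal R_n$ be an ideal generated by $r$ power series. 1. If $\dim\bigl(k[x]/\overline{I_l}\bigr)<n-r$ for some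 integer $l\ge 0$, then $I^{\mathrm{ec}}=\mathcal R_n$. 2. If, for some integer $l\ge 0$, $\dim\bigl(k[x]/\overline{I_l}\bigr)=n-r$ and $I_l$ can be generated by $r$ power series, then $I_l=I^{\mathrm{ec}}$. 3. In particular, if $\dim\bigl(k[x]/\overline{I}\bigr)=n-r$, then $I=I^{\mathrm{ec}}$. -/

import Mathlib

noncomputable section

namespace Strassmann

open MvPowerSeries

/-- The ring of integers `R = {a ∈ K : v(a) ≥ 0} = {a ∈ K : ‖a‖ ≤ 1}` of a non-Archimedean valued
field `K`. The real-valued valuation `v` is encoded by the norm, `‖a‖ = exp (-v a)`. -/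
abbrev RingOfIntegers (K : Type*) [NormedField K] [IsUltrametricDist K] : ValuationSubring K :=
  (NormedField.valuation (K := K)).valuationSubring

/-- The residue field `k = R / 𝔪`. -/
abbrev ResField (K : Type*) [NormedField K] [IsUltrametricDist K] : Type _ :=
  IsLocalRing.ResidueField (RingOfIntegers K)

/-- The ring `R⟨x₁, …, xₙ⟩` of power series `∑ a_I x^I` with `a_I ∈ R` and `v(a_I) → +∞`
(that is, `‖a_I‖ → 0`) as `|I| → ∞`; as there are finitely many variables, the latter is
convergence along the cofinite filter. -/
abbrev IntegralTate (K : Type*) [NormedField K] [IsUltrametricDist K] (n : ℕ) :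
    Subring (MvPowerSeries (Fin n) (RingOfIntegers K)) :=
  IsRestricted.subring (R := RingOfIntegers K) (fun _ : Fin n => (1 : ℝ))

variable {K : Type*} [NormedField K] [IsUltrametricDist K] {n : ℕ}

/-- The elements of `R` as constant power series. -/
def const (K : Type*) [NormedField K] [IsUltrametricDist K] (n : ℕ) :
    RingOfIntegers K →+* IntegralTate K n :=
  (C : RingOfIntegers K →+* MvPowerSeries (Fin n) (RingOfIntegers K)).codRestrict
    (IntegralTate K n) (fun a => isRestricted_C _ a)

theorem residue_eq_zero_of_norm_lt_one {a : RingOfIntegers K} (ha : ‖a‖ < 1) :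
    IsLocalRing.residue (RingOfIntegers K) a = 0 := by
  rw [IsLocalRing.residue_eq_zero_iff]
  exact (Valuation.mem_maximalIdeal_iff (v := NormedField.valuation (K := K))).2 ha

/-- Only finitely many coefficients of a convergent power series over `R` are non-zero in `k`. -/
theorem finite_support_residue (f : IntegralTate K n) :
    (Function.support fun t : Fin n →₀ ℕ =>
      IsLocalRing.residue (RingOfIntegers K) (coeff t f.1)).Finite := by
  have h : Filter.Tendsto (fun t : Fin n →₀ ℕ => ‖coeff t f.1‖ * t.prod fun _ e => (1 : ℝ) ^ e)
      Filter.cofinite (nhds 0) := f.2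
  have h1 := h.eventually (gt_mem_nhds (zero_lt_one : (0 : ℝ) < 1))
  refine Set.Finite.subset (Filter.eventually_cofinite.1 h1) fun t ht hlt => ht ?_
  apply residue_eq_zero_of_norm_lt_one
  simpa [Finsupp.prod] using hlt

/-- The reduction of a convergent power series over `R`, a polynomial over `k`. -/
def reductionFun (f : IntegralTate K n) : MvPolynomial (Fin n) (ResField K) :=
  ∑ t ∈ (finite_support_residue f).toFinset,
    MvPolynomial.monomial t (IsLocalRing.residue (RingOfIntegers K) (coeff t f.1))

theorem coe_reductionFun (f : IntegralTate K n) :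
    (reductionFun f : MvPowerSeries (Fin n) (ResField K)) =
      MvPowerSeries.map (IsLocalRing.residue (RingOfIntegers K)) f.1 := by
  ext t
  classical
  rw [MvPolynomial.coeff_coe, coeff_map, reductionFun, MvPolynomial.coeff_sum]
  simp only [MvPolynomial.coeff_monomial, Finset.sum_ite_eq', Set.Finite.mem_toFinset,
    Function.mem_support]
  split_ifs with h
  · rfl
  · exact (not_not.1 h).symm

/-- Coefficientwise reduction modulo `𝔪`, as a ring homomorphism `R⟨x₁, …, xₙ⟩ → k[x₁, …, xₙ]`. -/
def reduction (K : Type*) [NormedField K] [IsUltrametricDist K] (n : ℕ) :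
    IntegralTate K n →+* MvPolynomial (Fin n) (ResField K) where
  toFun := reductionFun
  map_one' := MvPolynomial.coe_injective _ _ (by simp [coe_reductionFun])
  map_mul' f g := MvPolynomial.coe_injective _ _ (by simp [coe_reductionFun])
  map_zero' := MvPolynomial.coe_injective _ _ (by simp [coe_reductionFun])
  map_add' f g := MvPolynomial.coe_injective _ _ (by simp [coe_reductionFun])

/-- The reduction `Ī ⊆ k[x₁, …, xₙ]` of an ideal `I` of `R⟨x₁, …, xₙ⟩`. -/
def reducedIdeal (I : Ideal (IntegralTate K n)) : Ideal (MvPolynomial (Fin n) (ResField K)) :=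
  I.map (reduction K n)

/-- The Krull dimension of `k[x₁, …, xₙ] / Ī` (it is `⊥`, i.e. `-∞`, for the zero ring). -/
def dimReduction (I : Ideal (IntegralTate K n)) : WithBot ℕ∞ :=
  ringKrullDim (MvPolynomial (Fin n) (ResField K) ⧸ reducedIdeal I)

/-- The saturation `I^ec = {f : ∃ a ∈ R \ {0}, a f ∈ I}`. -/
def saturation (I : Ideal (IntegralTate K n)) : Ideal (IntegralTate K n) where
  carrier := {f | ∃ a : RingOfIntegers K, a ≠ 0 ∧ const K n a * f ∈ I}
  zero_mem' := ⟨1, one_ne_zero, by simp⟩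
  add_mem' := by
    rintro f g ⟨a, ha, hf⟩ ⟨b, hb, hg⟩
    refine ⟨a * b, mul_ne_zero ha hb, ?_⟩
    have h := I.add_mem (I.mul_mem_left (const K n b) hf) (I.mul_mem_left (const K n a) hg)
    convert h using 1
    rw [map_mul]
    ring
  smul_mem' := by
    rintro c f ⟨a, ha, hf⟩
    refine ⟨a, ha, ?_⟩
    have h := I.mul_mem_left c hf
    convert h using 1
    rw [smul_eq_mul]
    ring

/-- For a uniformizer `ϖ`, the ideal
`I_l = ϖ⁻ˡ (I ∩ ϖˡ R⟨x⟩) = (I : ϖˡ R⟨x⟩) = {g : ϖˡ g ∈ I}`. -/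
def stepIdeal (ϖ : RingOfIntegers K) (I : Ideal (IntegralTate K n)) (l : ℕ) :
    Ideal (IntegralTate K n) :=
  Submodule.colon I (Ideal.span {const K n (ϖ ^ l)} : Ideal (IntegralTate K n))

/-- The ideal `I` can be generated by `r` power series (not necessarily distinct). -/
def GeneratedBy (I : Ideal (IntegralTate K n)) (r : ℕ) : Prop :=
  ∃ f : Fin r → IntegralTate K n, I = Ideal.span (Set.range f)

end Strassmann

end

/-! Write `A = R⟨x⟩`. It is `ϖ`-adically complete with `A/ϖ = k[x]`, hence Noetherian, and `ϖ` lies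
in its Jacobson radical. Since every non-zero `a ∈ R` divides a power of `ϖ`, saturating an ideal
means dividing by powers of `ϖ`.

Equality case. Let `J` have `r` generators and let its reduction have codimension `r`. As `k[x]` is
Cohen–Macaulay, suitable generators of `J` reduce to a regular sequence, so `Tor₁(A/ϖ, A/J) = 0`,
that is `(ϖ) ∩ J = ϖJ`. Thus `ϖg ∈ J` forces `g ∈ J`, and `J` is saturated. This is
`Ideal.ker_inf_le_ker_mul_of_finite_of_flat`, an induction on `r`. The Cohen–Macaulay property
enters as being finite and flat over a polynomial ring, which survives division by a
non-zero-divisor, at the cost of one variable.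

Strict inequality. If the saturation of `I` is proper, no power of `ϖ` lies in `I`, so some prime `P
⊇ I` is maximal among the primes avoiding `ϖ`. Three estimates give `n ≤ dim k[x]/Ī_l + r`: `n ≤ ht
P` (`natCast_le_height`), because `A/P` is integral over `R`, and freeing the variables one at a
time gives a chain of `n` strict inclusions below `P`; `ht P ≤ ht (P/I_l) + r`
(`height_le_height_map_add`), by Krull's height theorem; `ht (P/I_l) ≤ dim k[x]/Ī_l`
(`height_map_le_dimReduction`), because a maximal ideal above `P` contains `ϖ` and `P` does not. -/

/-! ### Adic completeness, finiteness and Noetherian rings -/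

theorem Ideal.exists_forall_pow_dvd_sub_sum {R : Type*} [CommRing R] (π : R)
    [IsPrecomplete (Ideal.span {π}) R] (c : ℕ → R) :
    ∃ F : R, ∀ n, π ^ n ∣ F - ∑ i ∈ Finset.range n, π ^ i * c i := by
  obtain ⟨F, hF⟩ := IsPrecomplete.prec (I := Ideal.span {π}) (M := R) inferInstance
    (f := fun n => ∑ i ∈ Finset.range n, π ^ i * c i) (by
      intro m n hmn
      rw [SModEq.sub_mem, ← neg_sub, ← Finset.sum_range_add_sum_Ico _ hmn, add_sub_cancel_left,
        smul_eq_mul, Ideal.mul_top, Ideal.span_singleton_pow, Ideal.mem_span_singleton]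
      refine (dvd_neg.2 (Finset.dvd_sum fun i hi => ?_))
      exact (pow_dvd_pow _ (Finset.mem_Ico.1 hi).1).mul_right _)
  refine ⟨F, fun n => ?_⟩
  have := (hF n).symm
  rwa [SModEq.sub_mem, smul_eq_mul, Ideal.mul_top, Ideal.span_singleton_pow,
    Ideal.mem_span_singleton] at this

/-- Successive approximation over a `π`-adically complete ring. -/
theorem exists_coeff_forall_eq_sum_add_pow_smul {R M ι : Type*} [CommRing R] [AddCommGroup M]
    [Module R M] [Fintype ι] (π : R) [IsPrecomplete (Ideal.span {π}) R] (N : Set M) (e : ι → M)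
    (h : ∀ x ∈ N, ∃ c : ι → R, ∃ y ∈ N, x = ∑ j, c j • e j + π • y) {x : M} (hx : x ∈ N) :
    ∃ C : ι → R, ∀ n : ℕ, ∃ y : M, x = ∑ j, C j • e j + π ^ n • y := by
  choose! c y hy hc using h
  have hmem : ∀ n : ℕ, y^[n] x ∈ N := fun n => by
    induction n with
    | zero => exact hx
    | succ n ih => rw [Function.iterate_succ_apply']; exact hy _ ih
  -- The remainders are the iterates of `y`; `C j` is the limit of the partial sums of their `j`-th
  -- coefficients, weighted by powers of `π`.
  choose C hC using fun j => Ideal.exists_forall_pow_dvd_sub_sum π fun i => c (y^[i] x) j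
  have key : ∀ n : ℕ, x = ∑ j, (∑ i ∈ Finset.range n, π ^ i * c (y^[i] x) j) • e j
      + π ^ n • y^[n] x := fun n => by
    induction n with
    | zero => simp
    | succ n ih =>
      conv_lhs => rw [ih, hc _ (hmem n)]
      simp only [Finset.sum_range_succ, add_smul, Finset.sum_add_distrib, smul_add,
        Finset.smul_sum, mul_smul, pow_succ, Function.iterate_succ_apply', add_assoc]
  refine ⟨C, fun n => ?_⟩
  choose d hd using fun j => hC j n
  refine ⟨y^[n] x - ∑ j, d j • e j, ?_⟩
  have hC' : ∀ j, C j = ∑ i ∈ Finset.range n, π ^ i * c (y^[i] x) j + π ^ n * d j := fun j => by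
    rw [← hd j]; ring
  simp only [hC', add_smul, Finset.sum_add_distrib, smul_sub, Finset.smul_sum, mul_smul]
  conv_lhs => rw [key n]
  abel

theorem IsHausdorff.eq_zero_of_forall_pow_smul {R M : Type*} [CommRing R] [AddCommGroup M]
    [Module R M] (π : R) [IsHausdorff (Ideal.span {π}) M] {x : M}
    (h : ∀ n : ℕ, ∃ y, x = π ^ n • y) : x = 0 := by
  refine IsHausdorff.haus (I := Ideal.span {π}) inferInstance x fun n => ?_
  obtain ⟨y, rfl⟩ := h n
  rw [SModEq.zero]
  exact Submodule.smul_mem_smul (Ideal.pow_mem_pow (Ideal.mem_span_singleton_self π) n)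
    Submodule.mem_top

theorem Module.Finite.of_isPrecomplete_span_singleton {R M ι : Type*} [CommRing R]
    [AddCommGroup M] [Module R M] [Fintype ι] (π : R) [IsPrecomplete (Ideal.span {π}) R]
    (e : ι → M) (hM : ∀ x : M, (∀ n : ℕ, ∃ y, x = π ^ n • y) → x = 0)
    (h : ∀ x : M, ∃ c : ι → R, ∃ y, x = ∑ j, c j • e j + π • y) : Module.Finite R M := by
  refine ⟨Submodule.fg_def.2 ⟨Set.range e, Set.finite_range e, eq_top_iff.2 fun x _ => ?_⟩⟩
  obtain ⟨C, hC⟩ := exists_coeff_forall_eq_sum_add_pow_smul π Set.univ e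
    (fun x _ => by
      obtain ⟨c, y, hy⟩ := h x
      exact ⟨c, y, Set.mem_univ _, hy⟩) (Set.mem_univ x)
  have h0 : x - ∑ j, C j • e j = 0 := hM _ fun n => by
    obtain ⟨y, hy⟩ := hC n
    exact ⟨y, by conv_lhs => rw [hy, add_sub_cancel_left]⟩
  rw [sub_eq_zero.1 h0]
  exact Submodule.sum_mem _ fun j _ => Submodule.smul_mem _ _ (Submodule.subset_span ⟨j, rfl⟩)

/-- By Cohen's theorem only primes `P` matter. Lift generators of the image of `P` modulo `π`. If `π
∈ P`, the lifts together with `π` generate `P`. If `π ∉ P`, then `πy ∈ P` forces `y ∈ P`, so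
successive approximation stays inside `P` and the lifts alone suffice. -/
theorem IsNoetherianRing.of_isAdicComplete_span_singleton {A : Type*} [CommRing A] (π : A)
    [IsAdicComplete (Ideal.span {π}) A] [IsNoetherianRing (A ⧸ Ideal.span {π})] :
    IsNoetherianRing A := by
  refine IsNoetherianRing.of_prime fun P hP => ?_
  obtain ⟨m, g, hg⟩ := Submodule.fg_iff_exists_fin_generating_family.1
    (IsNoetherian.noetherian (P.map (Ideal.Quotient.mk (Ideal.span {π}))))
  have hlift : ∀ i, ∃ e ∈ P, Ideal.Quotient.mk (Ideal.span {π}) e = g i := fun i =>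
    (Ideal.mem_map_iff_of_surjective _ Ideal.Quotient.mk_surjective).1
      (hg ▸ Submodule.subset_span (Set.mem_range_self i))
  choose e heP he using hlift
  have hstep : ∀ x ∈ P, ∃ c : Fin m → A, ∃ y, x = ∑ j, c j • e j + π • y := fun x hx => by
    have h1 := Ideal.mem_map_of_mem (Ideal.Quotient.mk (Ideal.span {π})) hx
    rw [← hg, Submodule.mem_span_range_iff_exists_fun] at h1
    obtain ⟨c', hc'⟩ := h1
    choose c hc using fun j => Ideal.Quotient.mk_surjective (c' j)
    have h2 : x - ∑ j, c j • e j ∈ Ideal.span {π} := by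
      rw [← Ideal.Quotient.eq_zero_iff_mem, map_sub, ← hc', map_sum, sub_eq_zero]
      simp [he, hc]
    obtain ⟨y, hy⟩ := Ideal.mem_span_singleton.1 h2
    exact ⟨c, y, by rw [smul_eq_mul π, ← hy]; ring⟩
  have hspan : Submodule.span A (Set.range e) ≤ P :=
    Submodule.span_le.2 (Set.range_subset_iff.2 heP)
  by_cases hπ : π ∈ P
  · have : P = Submodule.span A (Set.range e) ⊔ Submodule.span A {π} := by
      refine le_antisymm (fun x hx => ?_)
        (sup_le hspan (Submodule.span_le.2 (Set.singleton_subset_iff.2 hπ)))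
      obtain ⟨c, y, rfl⟩ := hstep x hx
      refine Submodule.add_mem_sup (Submodule.sum_mem _ fun j _ => Submodule.smul_mem _ _
        (Submodule.subset_span ⟨j, rfl⟩)) ?_
      rw [smul_eq_mul, mul_comm]
      exact Ideal.mul_mem_left _ _ (Ideal.mem_span_singleton_self π)
    rw [this]
    exact (Submodule.fg_span (Set.finite_range e)).sup (Submodule.fg_span (Set.finite_singleton π))
  · have : P = Submodule.span A (Set.range e) := by
      refine le_antisymm (fun x hx => ?_) hspan
      obtain ⟨C, hC⟩ := exists_coeff_forall_eq_sum_add_pow_smul π (P : Set A) e (fun x hx => by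
        obtain ⟨c, y, h⟩ := hstep x hx
        refine ⟨c, y, (hP.mem_or_mem (x := π) ?_).resolve_left hπ, h⟩
        rw [← smul_eq_mul, ← add_sub_cancel_left (∑ j, c j • e j) (π • y), ← h]
        exact P.sub_mem hx (P.sum_mem fun j _ => P.smul_mem _ (heP j))) hx
      have h0 : x - ∑ j, C j • e j = 0 :=
        IsHausdorff.eq_zero_of_forall_pow_smul π fun n => by
          obtain ⟨y, hy⟩ := hC n
          exact ⟨y, by conv_lhs => rw [hy, add_sub_cancel_left]⟩
      rw [sub_eq_zero.1 h0]
      exact Submodule.sum_mem _ fun j _ => Submodule.smul_mem _ _ (Submodule.subset_span ⟨j, rfl⟩)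
    rw [this]
    exact Submodule.fg_span (Set.finite_range e)

/-- In a Noetherian domain in which every non-zero prime contains `π ≠ 0`, the primes containing
`π` are maximal. -/
theorem Ideal.IsPrime.isMaximal_of_forall_ne_bot_mem {D : Type*} [CommRing D] [IsDomain D]
    [IsNoetherianRing D] {π : D} (hπ0 : π ≠ 0)
    (hπ : ∀ Q : Ideal D, Q.IsPrime → Q ≠ ⊥ → π ∈ Q) {q : Ideal D} (hq : q.IsPrime)
    (hπq : π ∈ q) : q.IsMaximal := by
  obtain ⟨m, hm, hqm⟩ := Ideal.exists_le_maximal q hq.ne_top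
  rcases hqm.eq_or_lt with rfl | hlt
  · exact hm
  -- If `q < m`, prime avoidance gives `a ∈ m` outside all minimal primes over `π`. A minimal prime
  -- `p` over `a` has height at most 1, yet it contains `π`, hence strictly contains a minimal prime
  -- `p'` over `π`, and `⊥ < p' < p`.
  exfalso
  obtain ⟨q', hq', hq'q⟩ := Ideal.exists_minimalPrimes_le
    ((Ideal.span_singleton_le_iff_mem _).2 hπq)
  have hfin := Ideal.finite_minimalPrimes_of_isNoetherianRing D (Ideal.span {π})
  have hnot : ¬ (m : Set D) ⊆ ⋃ p ∈ (Ideal.span {π}).minimalPrimes, (p : Set D) := by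
    intro hsub
    obtain ⟨p, hp, hmp⟩ := (Ideal.subset_union_prime_finite hfin (f := id) 0 0
      fun p hp _ _ => hp.1.1).1 hsub
    exact ((hq'q.trans_lt hlt).trans_le hmp).not_ge (hp.2 hq'.1 ((hq'q.trans hqm).trans hmp))
  obtain ⟨a, ham, ha⟩ := Set.not_subset.1 hnot
  simp only [Set.mem_iUnion, not_exists] at ha
  obtain ⟨p, hp, hpm⟩ := Ideal.exists_minimalPrimes_le ((Ideal.span_singleton_le_iff_mem _).2 ham)
  have hap : a ∈ p := hp.1.2 (Ideal.mem_span_singleton_self a)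
  have ha0 : a ≠ 0 := fun h => ha q' hq' (h ▸ q'.zero_mem)
  have hpprime := hp.1.1
  have hpbot : p ≠ ⊥ := fun h => ha0 (by simpa [h] using hap)
  obtain ⟨p', hp', hp'p⟩ := Ideal.exists_minimalPrimes_le
    ((Ideal.span_singleton_le_iff_mem _).2 (hπ p hpprime hpbot))
  have hlt' : p' < p := lt_of_le_of_ne hp'p fun h => ha p' hp' (h ▸ hap)
  have hp'prime := hp'.1.1
  have hp'bot : ⊥ < p' := bot_lt_iff_ne_bot.2 fun h => hπ0
    (by simpa [h] using hp'.1.2 (Ideal.mem_span_singleton_self π))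
  have h1 := Ideal.height_le_one_of_isPrincipal_of_mem_minimalPrimes (Ideal.span {a}) p hp
  have h2 := Ideal.height_strict_mono_of_isPrime_of_isPrime hlt'
  have h3 := Ideal.height_strict_mono_of_isPrime_of_isPrime hp'bot
  have h4 := Order.lt_one_iff.1 (h2.trans_le h1)
  rw [h4] at h3
  exact not_lt_bot h3

/-! ### Integral extensions, and flatness of quotients by one element -/

open scoped TensorProduct

theorem ringKrullDim_le_of_isIntegral_of_injective {R S : Type*} [CommRing R] [CommRing S]
    (f : R →+* S) (hf : f.IsIntegral) (hinj : Function.Injective f) :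
    ringKrullDim R ≤ ringKrullDim S := by
  algebraize [f]
  have : Algebra.IsIntegral R S := ⟨hf⟩
  refine iSup_le fun l => ?_
  obtain ⟨Q, -, hQ, hQl⟩ := Ideal.exists_ideal_over_prime_of_isIntegral l.head.asIdeal (⊥ : Ideal S)
    (le_of_eq_of_le ((RingHom.injective_iff_ker_eq_bot _).1 hinj) bot_le)
  have : Q.LiesOver l.head.asIdeal := ⟨hQl.symm⟩
  obtain ⟨L, hL, -⟩ := Ideal.exists_ltSeries_of_hasGoingUp l Q
  rw [← hL]
  exact le_iSup (fun l : LTSeries (PrimeSpectrum S) => ((l.length : ℕ) : WithBot ℕ∞)) L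

theorem LinearMap.lTensor_rTensor_apply {R X Y V W : Type*} [CommRing R] [AddCommGroup X]
    [Module R X] [AddCommGroup Y] [Module R Y] [AddCommGroup V] [Module R V] [AddCommGroup W]
    [Module R W] (a : V →ₗ[R] W) (b : X →ₗ[R] Y) (t : V ⊗[R] X) :
    b.lTensor W (a.rTensor X t) = a.rTensor Y (b.lTensor V t) := by
  rw [← LinearMap.comp_apply, ← LinearMap.comp_apply, LinearMap.lTensor_comp_rTensor,
    LinearMap.rTensor_comp_lTensor]

namespace Module.Flat

/-- If multiplication by the elements of `T` which is regular on `T ⊗[R] N`, it stays regular after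
tensoring `N` with a flat `T`-module. -/
theorem isSMulRegular_tensorProduct {R T B N : Type*} [CommRing R] [CommRing T] [CommRing B]
    [Algebra R T] [Algebra T B] [Algebra R B] [IsScalarTower R T B] [AddCommGroup N] [Module R N]
    [Module.Flat T B] {q : T} (h : IsSMulRegular (T ⊗[R] N) q) : IsSMulRegular (B ⊗[R] N) q :=
  ((TensorProduct.AlgebraTensorModule.cancelBaseChange R T T B N).isSMulRegular_congr q).1
    (h.lTensor B)

theorem isSMulRegular_polynomial_tensorProduct {R : Type*} [CommRing R] (I : Ideal R)
    {q : Polynomial R} (hq : IsUnit q.leadingCoeff) :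
    IsSMulRegular (Polynomial R ⊗[R] (R ⧸ I)) q := by
  let e : Polynomial R ⊗[R] (R ⧸ I) ≃ₐ[R] Polynomial (R ⧸ I) :=
    (Algebra.TensorProduct.comm R _ _).trans (polyEquivTensor R (R ⧸ I)).symm
  have he : ∀ z, e (q • z) = q.map (Ideal.Quotient.mk I) * e z := fun z => by
    have : q • z = (q ⊗ₜ[R] (1 : R ⧸ I)) * z := by
      induction z with
      | zero => simp
      | add x y hx hy => rw [smul_add, mul_add, hx, hy]
      | tmul a b => simp [TensorProduct.smul_tmul']
    rw [this, map_mul]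
    congr 1
    simp [e, Ideal.Quotient.algebraMap_eq]
  have hu : IsUnit (q.map (Ideal.Quotient.mk I)).leadingCoeff ∨ Subsingleton (R ⧸ I) := by
    rcases subsingleton_or_nontrivial (R ⧸ I) with h | h
    · exact Or.inr h
    · left
      rw [Polynomial.leadingCoeff_map_of_leadingCoeff_ne_zero _ (hq.map _).ne_zero]
      exact hq.map _
  intro x y hxy
  apply e.injective
  have h1 : q.map (Ideal.Quotient.mk I) * e x = q.map (Ideal.Quotient.mk I) * e y := by
    rw [← he, ← he]; exact congrArg e hxy
  rcases hu with hu | hu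
  · have hreg : q.map (Ideal.Quotient.mk I) ∈ nonZeroDivisors _ :=
      Polynomial.mem_nonzeroDivisors_of_coeff_mem _ hu.mem_nonZeroDivisors
    rw [← sub_eq_zero, ← mul_sub, mul_comm] at h1
    exact sub_eq_zero.1 ((mem_nonZeroDivisors_iff_right.1 hreg) _ h1)
  · exact Subsingleton.elim _ _

/-- The cokernel of an endomorphism that stays injective modulo every ideal is flat. -/
theorem of_injective_rTensor_quotient {R B Q : Type*} [CommRing R] [AddCommGroup B] [Module R B]
    [AddCommGroup Q] [Module R Q] [Module.Flat R B] (h : B →ₗ[R] B) (p : B →ₗ[R] Q)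
    (hp : Function.Surjective p) (hex : Function.Exact h p)
    (hinj : ∀ I : Ideal R, Function.Injective (h.rTensor (R ⧸ I))) : Module.Flat R Q := by
  rw [Module.Flat.iff_lTensor_injective]
  -- Snake-type chase: lift `z` to `w ∈ I ⊗ B`, whose image in `R ⊗ B` is `h v`. Injectivity of `h`
  -- modulo `I` makes `v` vanish modulo `I`, so `v` comes from `I ⊗ B`; as `B` is flat, `w` is
  -- itself in the image of `h`, and `z = 0`.
  intro I _
  rw [injective_iff_map_eq_zero]
  intro z hz
  obtain ⟨w, rfl⟩ := LinearMap.rTensor_surjective I hp z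
  rw [LinearMap.lTensor_rTensor_apply] at hz
  obtain ⟨v, hv⟩ := (_root_.rTensor_exact R hex hp _).1 hz
  have hv0 : (Submodule.mkQ I).lTensor B v = 0 := by
    apply hinj I
    rw [map_zero, ← LinearMap.lTensor_rTensor_apply, hv, ← LinearMap.comp_apply, ← LinearMap.lTensor_comp]
    have : (Submodule.mkQ I).comp (Submodule.subtype I) = 0 :=
      (LinearMap.exact_subtype_mkQ I).linearMap_comp_eq_zero
    rw [this]; simp
  obtain ⟨v', rfl⟩ := (_root_.lTensor_exact B (LinearMap.exact_subtype_mkQ I) (Submodule.mkQ_surjective I)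
    _).1 hv0
  rw [← LinearMap.lTensor_rTensor_apply] at hv
  have hw := Module.Flat.lTensor_preserves_injective_linearMap (M := B) _ I.subtype_injective hv
  rw [← hw, ← LinearMap.comp_apply, ← LinearMap.rTensor_comp, hex.linearMap_comp_eq_zero]
  simp

end Module.Flat

/-- A finite flat algebra over `R[X]`, modulo a divisor of a polynomial with invertible leading
coefficient, is finite and flat over `R`. -/
theorem RingHom.finite_flat_quotient_comp_C {R B : Type*} [CommRing R] [CommRing B]
    (ψ : Polynomial R →+* B) (hfin : ψ.Finite) (hflat : ψ.Flat) {q : Polynomial R}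
    (hq : IsUnit q.leadingCoeff) {h g : B} (hg : ψ q = h * g) :
    ((Ideal.Quotient.mk (Ideal.span {h})).comp (ψ.comp Polynomial.C)).Finite ∧
    ((Ideal.Quotient.mk (Ideal.span {h})).comp (ψ.comp Polynomial.C)).Flat := by
  constructor
  · have hmonic := Polynomial.monic_of_isUnit_leadingCoeff_inv_smul hq
    set q' : Polynomial R := hq.unit⁻¹ • q with hq'
    have h0 : ∀ a ∈ Ideal.span {q'}, (Ideal.Quotient.mk (Ideal.span {h})).comp ψ a = 0 := by
      intro a ha
      obtain ⟨b, rfl⟩ := Ideal.mem_span_singleton.1 ha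
      have hψq' : ψ q' = ψ (Polynomial.C ((hq.unit⁻¹ : Rˣ) : R)) * (h * g) := by
        rw [hq', Units.smul_def, Polynomial.smul_eq_C_mul, map_mul, hg]
      rw [RingHom.comp_apply, map_mul, hψq', Ideal.Quotient.eq_zero_iff_mem]
      exact Ideal.mem_span_singleton.2 ⟨ψ (Polynomial.C ((hq.unit⁻¹ : Rˣ) : R)) * g * ψ b, by ring⟩
    have h1 : (Ideal.Quotient.lift (Ideal.span {q'}) _ h0).Finite := by
      refine RingHom.Finite.of_comp_finite (f := Ideal.Quotient.mk _) ?_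
      rw [Ideal.Quotient.lift_comp_mk]
      exact (RingHom.Finite.of_surjective _ Ideal.Quotient.mk_surjective).comp hfin
    have h2 : ((Ideal.Quotient.mk (Ideal.span {q'})).comp Polynomial.C).Finite := by
      have := hmonic.finite_quotient
      exact RingHom.finite_algebraMap.2 this
    have h3 := h1.comp h2
    rwa [← RingHom.comp_assoc, Ideal.Quotient.lift_comp_mk] at h3
  · algebraize [ψ, ψ.comp Polynomial.C]
    have : IsScalarTower R (Polynomial R) B := IsScalarTower.of_algebraMap_eq fun _ => rfl
    have : Module.Flat R B := Module.Flat.trans R (Polynomial R) B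
    have key : Module.Flat R (B ⧸ Ideal.span {h}) := by
      refine Module.Flat.of_injective_rTensor_quotient (LinearMap.mulLeft R h)
        (Ideal.Quotient.mkₐ R (Ideal.span {h})).toLinearMap Ideal.Quotient.mk_surjective ?_ ?_
      · intro b
        constructor
        · intro hb
          obtain ⟨c, rfl⟩ := Ideal.mem_span_singleton.1 (Ideal.Quotient.eq_zero_iff_mem.1 hb)
          exact ⟨c, rfl⟩
        · rintro ⟨c, rfl⟩
          exact Ideal.Quotient.eq_zero_iff_mem.2 (Ideal.mem_span_singleton.2 ⟨c, rfl⟩)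
      · intro I
        -- The leading coefficient of `q` stays invertible modulo `I`, so `q` is regular on
        -- `(R/I)[X]`, and on `B ⊗ R/I` by flatness over `R[X]`. Since `q` acts as `g * h`, the
        -- factor `h` is injective too.
        have hreg : IsSMulRegular (B ⊗[R] (R ⧸ I)) q :=
          Module.Flat.isSMulRegular_tensorProduct
            (Module.Flat.isSMulRegular_polynomial_tensorProduct I hq)
        have hcomp : ∀ z, ((LinearMap.mulLeft R g).rTensor (R ⧸ I))
            ((LinearMap.mulLeft R h).rTensor (R ⧸ I) z) = q • z := fun z => by
          rw [← LinearMap.comp_apply, ← LinearMap.rTensor_comp]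
          induction z with
          | zero => simp
          | add x y hx hy => rw [map_add, smul_add, hx, hy]
          | tmul b y =>
            rw [LinearMap.rTensor_tmul, TensorProduct.smul_tmul', Algebra.smul_def,
              RingHom.algebraMap_toAlgebra, hg]
            simp only [LinearMap.comp_apply, LinearMap.mulLeft_apply]
            congr 1; ring
        intro x y hxy
        apply hreg
        simp only [← hcomp, hxy]
    exact key

/-! ### Nagata's change of variables -/

namespace MvPolynomial

open Polynomial

variable {k : Type*} [Field k] {n : ℕ}

/-- The substitution `X i ↦ X i + c • X 0 ^ N ^ i` for `i ≠ 0`, fixing `X 0`. -/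
noncomputable abbrev nagataHom (N : ℕ) (c : k) :
    MvPolynomial (Fin (n + 1)) k →ₐ[k] MvPolynomial (Fin (n + 1)) k :=
  aeval fun i => if i = 0 then X 0 else X i + c • X 0 ^ N ^ (i : ℕ)

theorem nagataHom_comp_neg (N : ℕ) (c : k) :
    (nagataHom (n := n) N c).comp (nagataHom N (-c)) = AlgHom.id _ _ := by
  rw [comp_aeval, ← MvPolynomial.aeval_X_left]
  ext i v
  cases i using Fin.cases <;> simp

/-- Nagata's change of variables. -/
noncomputable abbrev nagataEquiv (k : Type*) [Field k] (n N : ℕ) :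
    MvPolynomial (Fin (n + 1)) k ≃ₐ[k] MvPolynomial (Fin (n + 1)) k :=
  AlgEquiv.ofAlgHom (nagataHom N 1) (nagataHom N (-1)) (nagataHom_comp_neg N 1)
    (by simpa using nagataHom_comp_neg N (-1 : k))

theorem sum_pow_mul_ne {N : ℕ} (hN : 1 < N) {v w : Fin (n + 1) →₀ ℕ} (hv : ∀ i, v i < N)
    (hw : ∀ i, w i < N) (ne : v ≠ w) :
    ∑ x : Fin (n + 1), N ^ (x : ℕ) * v x ≠ ∑ x : Fin (n + 1), N ^ (x : ℕ) * w x := by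
  intro h
  refine ne <| Finsupp.ext <| congrFun <| List.ofFn_inj.mp ?_
  apply Nat.ofDigits_inj_of_len_eq hN (by simp) (by grind) (by grind)
  simpa only [Nat.ofDigits_eq_sum_mapIdx, List.mapIdx_eq_ofFn, List.get_ofFn, List.length_ofFn,
    Fin.val_cast, mul_comm, List.sum_ofFn] using! h

theorem degreeOf_zero_nagataEquiv_monomial {N : ℕ} (hN : 0 < N)
    (v : Fin (n + 1) →₀ ℕ) {a : k} (ha : a ≠ 0) :
    (nagataEquiv k n N (monomial v a)).degreeOf 0 = ∑ i : Fin (n + 1), N ^ (i : ℕ) * v i := by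
  rw [← natDegree_finSuccEquiv, monomial_eq, Finsupp.prod_pow v fun a ↦ X a]
  simp only [Fin.prod_univ_succ, Fin.sum_univ_succ, map_mul, map_prod, map_pow,
    AlgEquiv.ofAlgHom_apply, MvPolynomial.aeval_C, MvPolynomial.aeval_X, if_pos, Fin.succ_ne_zero,
    ite_false, one_smul, map_add, finSuccEquiv_X_zero, finSuccEquiv_X_succ, algebraMap_eq]
  have h (i : Fin n) :
      (Polynomial.C (X (R := k) i) + Polynomial.X ^ N ^ (i.succ : ℕ)) ^ v i.succ ≠ 0 :=
    pow_ne_zero (v i.succ) (leadingCoeff_ne_zero.mp <| by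
      simp [add_comm, leadingCoeff_X_pow_add_C, hN])
  rw [natDegree_mul (by simp [ha]) (mul_ne_zero (by simp) (Finset.prod_ne_zero_iff.mpr
    (fun i _ ↦ h i))), natDegree_mul (by simp) (Finset.prod_ne_zero_iff.mpr (fun i _ ↦ h i)),
    natDegree_prod _ _ (fun i _ ↦ h i), natDegree_finSuccEquiv, degreeOf_C]
  simpa only [natDegree_pow, zero_add, natDegree_X, mul_one, Fin.val_zero, pow_zero, one_mul,
    add_right_inj] using Finset.sum_congr rfl (fun i _ ↦ by
    rw [add_comm (Polynomial.C _), natDegree_X_pow_add_C, mul_comm])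

theorem leadingCoeff_finSuccEquiv_nagataEquiv_monomial {N : ℕ} (hN : 0 < N)
    (v : Fin (n + 1) →₀ ℕ) (a : k) :
    (finSuccEquiv k n (nagataEquiv k n N (monomial v a))).leadingCoeff = algebraMap k _ a := by
  rw [monomial_eq, Finsupp.prod_fintype]
  · simp only [map_mul, map_prod, leadingCoeff_mul, leadingCoeff_prod]
    rw [AlgEquiv.ofAlgHom_apply, algHom_C, algebraMap_eq, finSuccEquiv_apply,
      eval₂Hom_C, RingHom.coe_comp]
    simp only [AlgEquiv.ofAlgHom_apply, Function.comp_apply, leadingCoeff_C, map_pow,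
      leadingCoeff_pow, algebraMap_eq]
    have : ∀ j, ((finSuccEquiv k n) (nagataHom N 1 (X j))).leadingCoeff = 1 := fun j ↦ by
      by_cases h : j = 0
      · simp [h, finSuccEquiv_apply]
      · simp only [aeval_eq_bind₁, bind₁_X_right, if_neg h, one_smul, map_add, map_pow]
        obtain ⟨i, rfl⟩ := Fin.exists_succ_eq.mpr h
        simp [finSuccEquiv_X_succ, finSuccEquiv_X_zero, add_comm, hN]
    simp only [this, one_pow, Finset.prod_const_one, mul_one]
  exact fun i ↦ pow_zero _

/-- After a change of variables, a non-zero polynomial over a field has an invertible leading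
coefficient in the first variable. -/
theorem exists_algEquiv_isUnit_leadingCoeff {f : MvPolynomial (Fin (n + 1)) k} (fne : f ≠ 0) :
    ∃ σ : MvPolynomial (Fin (n + 1)) k ≃ₐ[k] Polynomial (MvPolynomial (Fin n) k),
      IsUnit (σ f).leadingCoeff := by
  -- With `N` above every exponent in `f`, the weights `∑ N ^ i * v i` are base-`N` expansions.
  -- Distinct monomials of `f` thus get distinct degrees in `X 0`, and the leading coefficient is
  -- that of a single monomial.
  obtain ⟨N, hN, hlt⟩ : ∃ N, 1 < N ∧ ∀ v ∈ f.support, ∀ i, v i < N :=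
    ⟨2 + f.totalDegree, by lia, fun v hv i =>
      lt_of_le_of_lt ((monomial_le_degreeOf i hv).trans (degreeOf_le_totalDegree f i)) (by lia)⟩
  obtain ⟨T, hdeg, hlead⟩ : ∃ T : MvPolynomial (Fin (n + 1)) k ≃ₐ[k] MvPolynomial (Fin (n + 1)) k,
      (∀ v, ∀ a : k, a ≠ 0 →
        (T (monomial v a)).degreeOf 0 = ∑ i : Fin (n + 1), N ^ (i : ℕ) * v i) ∧
      ∀ v a, (finSuccEquiv k n (T (monomial v a))).leadingCoeff = algebraMap k _ a :=
    ⟨nagataEquiv k n N, fun v a ha => degreeOf_zero_nagataEquiv_monomial (by lia) v ha,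
      leadingCoeff_finSuccEquiv_nagataEquiv_monomial (by lia)⟩
  refine ⟨T.trans (finSuccEquiv k n), ?_⟩
  rw [AlgEquiv.trans_apply]
  obtain ⟨v, vin, vs⟩ := Finset.exists_max_image f.support
    (fun v ↦ (T ((monomial v) (coeff v f))).degreeOf 0) (support_nonempty.mpr fne)
  set h := fun w ↦ (MvPolynomial.monomial w) (coeff w f)
  have hne : ∀ x ∈ f.support, x ≠ v → (T (h x)).degreeOf 0 ≠ (T (h v)).degreeOf 0 := by
    intro x hx hxv
    rw [hdeg _ _ (mem_support_iff.mp hx), hdeg _ _ (mem_support_iff.mp vin)]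
    exact sum_pow_mul_ne hN (hlt x hx) (hlt v vin) hxv
  simp only [← natDegree_finSuccEquiv] at vs
  replace vs : ∀ x ∈ f.support \ {v}, (finSuccEquiv k n (T (h x))).degree <
      (finSuccEquiv k n (T (h v))).degree := by
    intro x hx
    obtain ⟨h1, h2⟩ := Finset.mem_sdiff.mp hx
    apply degree_lt_degree <| lt_of_le_of_ne (vs x h1) ?_
    simpa only [natDegree_finSuccEquiv] using hne x h1 (by simpa using h2)
  have coeff : (finSuccEquiv k n (T (h v + ∑ x ∈ f.support \ {v}, h x))).leadingCoeff =
      (finSuccEquiv k n (T (h v))).leadingCoeff := by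
    simp only [map_add, map_sum]
    rw [add_comm]
    apply leadingCoeff_add_of_degree_lt <| (lt_of_le_of_lt <| degree_sum_le _ _) ?_
    have h2 : h v ≠ 0 := by simpa [h] using mem_support_iff.mp vin
    replace h2 : (finSuccEquiv k n (T (h v))) ≠ 0 := fun eq ↦ h2 <|
      by simpa only [map_eq_zero_iff _ (AlgEquiv.injective _)] using eq
    exact (Finset.sup_lt_iff <| Ne.bot_lt (fun x ↦ h2 <| degree_eq_bot.mp x)).mpr vs
  have hsum : f = h v + ∑ x ∈ f.support \ {v}, h x := by
    conv_lhs => rw [← f.support_sum_monomial_coeff]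
    exact Finset.sum_eq_add_sum_sdiff_singleton_of_mem vin h
  rw [hsum, coeff, hlead]
  exact (mem_support_iff.mp vin).isUnit.map MvPolynomial.C

end MvPolynomial

/-! ### Prime avoidance for cosets -/

/-- If a coset generator `a` and the ideal `J` are not both contained in any of finitely many
primes, some element of `a + J` avoids all these primes. -/
theorem Ideal.exists_mem_forall_add_notMem {R : Type*} [CommRing R] (a : R) (J : Ideal R)
    (s : Finset (Ideal R)) (hs : ∀ p ∈ s, p.IsPrime) (h : ∀ p ∈ s, a ∈ p → ¬ J ≤ p) :
    ∃ c ∈ J, ∀ p ∈ s, a + c ∉ p := by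
  classical
  induction s using Finset.strongInduction with
  | H s ih =>
    rcases s.eq_empty_or_nonempty with rfl | hne
    · exact ⟨0, J.zero_mem, by simp⟩
    obtain ⟨p, hp⟩ := s.exists_minimal hne
    obtain ⟨c, hcJ, hc⟩ := ih (s.erase p) (Finset.erase_ssubset hp.1)
      (fun q hq => hs q (Finset.mem_of_mem_erase hq))
      (fun q hq => h q (Finset.mem_of_mem_erase hq))
    by_cases hacp : a + c ∈ p
    · have hJp : ¬ J ≤ p := fun hJ => h p hp.1 (by simpa using p.sub_mem hacp (hJ hcJ)) hJ
      have hnot : ¬ J ⊓ (s.erase p).inf id ≤ p := fun hle => by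
        have hpp := hs p hp.1
        rcases hpp.inf_le.1 hle with h1 | h1
        · exact hJp h1
        · obtain ⟨q, hq, hqp⟩ := hpp.inf_le'.1 h1
          exact Finset.ne_of_mem_erase hq
            (le_antisymm hqp (hp.2 (Finset.mem_of_mem_erase hq) hqp))
      obtain ⟨d, hd, hdp⟩ := SetLike.not_le_iff_exists.1 hnot
      refine ⟨c + d, J.add_mem hcJ hd.1, fun q hq => ?_⟩
      rw [← add_assoc]
      by_cases hqp : q = p
      · subst hqp
        exact fun hmem => hdp (by simpa using q.sub_mem hmem hacp)
      · have hq' := Finset.mem_erase.2 ⟨hqp, hq⟩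
        have hdq : d ∈ q := (Finset.inf_le hq' : (s.erase p).inf id ≤ q) hd.2
        exact fun hmem => hc q hq' (by simpa using q.sub_mem hmem hdq)
    · refine ⟨c, hcJ, fun q hq => ?_⟩
      by_cases hqp : q = p
      · rwa [hqp]
      · exact hc q (Finset.mem_erase.2 ⟨hqp, hq⟩)

/-- In a Noetherian ring, a sum `span {a} ⊔ J` containing a non-zero-divisor contains one of the
form `a + c` with `c ∈ J`. -/
theorem Ideal.exists_mem_add_mem_nonZeroDivisors {R : Type*} [CommRing R] [IsNoetherianRing R]
    (a : R) (J : Ideal R) {d : R} (hd : d ∈ nonZeroDivisors R) (hdJ : d ∈ Ideal.span {a} ⊔ J) :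
    ∃ c ∈ J, a + c ∈ nonZeroDivisors R := by
  have hfin := associatedPrimes.finite R R
  have key : ∀ r : R, r ∈ nonZeroDivisors R ↔ ∀ p ∈ associatedPrimes R R, r ∉ p := fun r => by
    have := Set.ext_iff.1 (biUnion_associatedPrimes_eq_compl_nonZeroDivisors R) r
    simp only [Set.mem_iUnion, SetLike.mem_coe, Set.mem_compl_iff] at this
    grind
  obtain ⟨c, hc, h⟩ := Ideal.exists_mem_forall_add_notMem a J hfin.toFinset
    (fun p hp => ((Set.Finite.mem_toFinset hfin).1 hp).isPrime) (fun p hp hap hJ =>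
      (key d).1 hd p ((Set.Finite.mem_toFinset hfin).1 hp)
        ((sup_le ((Ideal.span_singleton_le_iff_mem p).2 hap) hJ : _ ≤ p) hdJ))
  exact ⟨c, hc, (key _).2 fun p hp => h p ((Set.Finite.mem_toFinset hfin).2 hp)⟩

/-! ### Finite flat algebras over polynomial rings, and the vanishing of Tor -/

namespace MvPolynomial

variable {k : Type*} [Field k]

/-- Cancelling powers of `h` in an integral equation leaves a non-zero constant term, which `h`
divides. -/
theorem exists_ne_zero_dvd_of_mem_nonZeroDivisors {R B : Type*} [CommRing R] [IsDomain R]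
    [CommRing B] {ψ : R →+* B} (hψ : ψ.IsIntegral) {h : B} (hh : h ∈ nonZeroDivisors B) :
    ∃ s : R, s ≠ 0 ∧ h ∣ ψ s := by
  algebraize [ψ]
  exact IsAlgebraic.exists_nonzero_dvd (R := R) (IsIntegral.isAlgebraic (hψ h)) hh

/-- A non-zero multiple of `h` coming from the polynomial ring acquires an invertible leading
coefficient after Nagata's substitution. The distinguished variable can then be dropped. -/
theorem exists_finite_flat_quotient_span_singleton {m : ℕ} {B : Type*} [CommRing B]
    (ψ : MvPolynomial (Fin (m + 1)) k →+* B) (hfin : ψ.Finite) (hflat : ψ.Flat) {h : B}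
    (hh : h ∈ nonZeroDivisors B) :
    ∃ ψ' : MvPolynomial (Fin m) k →+* B ⧸ Ideal.span {h}, ψ'.Finite ∧ ψ'.Flat := by
  obtain ⟨s, hs, g, hg⟩ := exists_ne_zero_dvd_of_mem_nonZeroDivisors hfin.to_isIntegral hh
  obtain ⟨σ, hσ⟩ := exists_algEquiv_isUnit_leadingCoeff hs
  have hbij : Function.Bijective σ.symm.toRingEquiv.toRingHom := σ.symm.bijective
  exact ⟨_, RingHom.finite_flat_quotient_comp_C (ψ.comp σ.symm.toRingEquiv.toRingHom)
    (hfin.comp (RingHom.Finite.of_surjective _ hbij.2))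
    ((RingHom.Flat.of_bijective hbij).comp hflat) hσ (g := g) (by simpa using hg)⟩

/-- Otherwise the polynomial ring embeds integrally in `B ⧸ J`, whose dimension is then at least
`m`. -/
theorem exists_ne_zero_map_mem_of_ringKrullDim_lt {m : ℕ} {B : Type*} [CommRing B]
    {ψ : MvPolynomial (Fin m) k →+* B} (hfin : ψ.IsIntegral) (J : Ideal B)
    (hdim : ringKrullDim (B ⧸ J) < m) : ∃ s, s ≠ 0 ∧ ψ s ∈ J := by
  by_contra! hcon
  have hint : ((Ideal.Quotient.mk J).comp ψ).IsIntegral :=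
    hfin.trans _ _ (RingHom.isIntegral_of_surjective _ Ideal.Quotient.mk_surjective)
  have := ringKrullDim_le_of_isIntegral_of_injective _ hint (by
    rw [injective_iff_map_eq_zero]
    intro s hs
    by_contra hs0
    exact hcon s hs0 (Ideal.Quotient.eq_zero_iff_mem.1 hs))
  rw [MvPolynomial.ringKrullDim_of_isNoetherianRing, ringKrullDim_eq_zero_of_field] at this
  simp at this
  exact absurd hdim this.not_gt

end MvPolynomial

theorem RingHom.Flat.map_mem_nonZeroDivisors {R B : Type*} [CommRing R] [IsDomain R] [CommRing B]
    {ψ : R →+* B} (hψ : ψ.Flat) {s : R} (hs : s ≠ 0) : ψ s ∈ nonZeroDivisors B := by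
  algebraize [ψ]
  have : IsSMulRegular B s := IsSMulRegular.of_flat
    (isSMulRegular_iff_right_eq_zero_of_smul.2 fun x hx => (mul_eq_zero.1 hx).resolve_left hs)
  rw [mem_nonZeroDivisors_iff_right]
  intro x hx
  exact isSMulRegular_iff_right_eq_zero_of_smul.1 this x (by rw [Algebra.smul_def, mul_comm]; exact hx)

theorem WithBot.exists_nat_of_add_natCast_eq {x : WithBot ℕ∞} {r m : ℕ}
    (h : x + (r : WithBot ℕ∞) = m) : ∃ d : ℕ, x = d ∧ d + r = m := by
  induction x with
  | bot => exact absurd h (by rw [WithBot.bot_add]; exact WithBot.bot_ne_coe)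
  | coe x =>
    induction x with
    | top => exact absurd (WithBot.coe_injective h) (by simp)
    | coe d => exact ⟨d, rfl, by exact_mod_cast h⟩

/-- Let `B = A ⧸ N` be finite and flat over a polynomial ring in `m` variables, and let `J` be an
ideal with `r` generators such that `B ⧸ J` has dimension `m - r`. Then `N ⊓ J = N * J`. -/
theorem Ideal.ker_inf_le_ker_mul_of_finite_of_flat {k A : Type*} [Field k] [CommRing A] (r : ℕ) :
    ∀ {m : ℕ} {B : Type*} [CommRing B] (φ : A →+* B) (_ : Function.Surjective φ)
      (ψ : MvPolynomial (Fin m) k →+* B) (_ : ψ.Finite) (_ : ψ.Flat) (F : Fin r → A)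
      (_ : ringKrullDim (B ⧸ (Ideal.span (Set.range F)).map φ) + (r : WithBot ℕ∞) = m),
      RingHom.ker φ ⊓ Ideal.span (Set.range F) ≤ RingHom.ker φ * Ideal.span (Set.range F) := by
  induction r with
  | zero => intro m B _ φ _ ψ _ _ F _; simp
  | succ r ih =>
    intro m B _ φ hφ ψ hfin hflat F hdim
    obtain ⟨d, hd, hm⟩ := WithBot.exists_nat_of_add_natCast_eq hdim
    obtain ⟨m, rfl⟩ : ∃ m', m = m' + 1 := ⟨d + r, by lia⟩
    have : IsNoetherianRing B := by
      algebraize [ψ]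
      exact IsNoetherianRing.of_finite (MvPolynomial (Fin (m + 1)) k) B
    set J' := Ideal.span (Set.range (F ∘ Fin.succ)) with hJ'
    have hJ : Ideal.span (Set.range F) = Ideal.span {F 0} ⊔ J' := by
      rw [hJ', ← Ideal.span_union]
      congr 1
      ext x
      simp [Fin.exists_fin_succ, eq_comm]
    -- The dimension is below `m + 1`, so the image of the ideal in `B` contains `ψ s` with `s ≠ 0`,
    -- a non-zero-divisor by flatness. Hence `F 0` can be changed by an element of `J'` into some
    -- `H` regular on `B`.
    obtain ⟨s, hs0, hs⟩ := MvPolynomial.exists_ne_zero_map_mem_of_ringKrullDim_lt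
      hfin.to_isIntegral ((Ideal.span (Set.range F)).map φ) (by
        rw [hd]; exact_mod_cast (show d < m + 1 by lia))
    rw [hJ, Ideal.map_sup, Ideal.map_span, Set.image_singleton] at hs
    obtain ⟨c, hc, hreg⟩ := Ideal.exists_mem_add_mem_nonZeroDivisors (φ (F 0)) (J'.map φ)
      (hflat.map_mem_nonZeroDivisors hs0) hs
    obtain ⟨c, hcJ, rfl⟩ := (Ideal.mem_map_iff_of_surjective φ hφ).1 hc
    rw [← map_add] at hreg
    set H := F 0 + c with hH
    have hJH : Ideal.span (Set.range F) = Ideal.span {H} ⊔ J' := by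
      rw [hJ]
      refine le_antisymm (sup_le ?_ le_sup_right) (sup_le ?_ le_sup_right) <;>
        rw [Ideal.span_singleton_le_iff_mem]
      · rw [show F 0 = H - c by rw [hH]; ring]
        exact Ideal.sub_mem _ (Ideal.mem_sup_left (Ideal.mem_span_singleton_self _))
          (Ideal.mem_sup_right hcJ)
      · exact Ideal.add_mem _ (Ideal.mem_sup_left (Ideal.mem_span_singleton_self _))
          (Ideal.mem_sup_right hcJ)
    obtain ⟨ψ', hfin', hflat'⟩ :=
      MvPolynomial.exists_finite_flat_quotient_span_singleton ψ hfin hflat hreg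
    -- The induction runs on `B ⧸ (φ H)` and `J'`: one generator and one variable fewer. The new
    -- kernel is `ker φ + (H)`.
    set φ' := (Ideal.Quotient.mk (Ideal.span {φ H})).comp φ with hφ'
    have hker : ∀ x, x ∈ RingHom.ker φ' ↔ ∃ a, x - a * H ∈ RingHom.ker φ := fun x => by
      rw [RingHom.mem_ker, hφ', RingHom.comp_apply, Ideal.Quotient.eq_zero_iff_mem,
        Ideal.mem_span_singleton']
      constructor
      · rintro ⟨b, hb⟩
        obtain ⟨a, rfl⟩ := hφ b
        exact ⟨a, by rw [RingHom.mem_ker, map_sub, map_mul, hb, sub_self]⟩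
      · rintro ⟨a, ha⟩
        rw [RingHom.mem_ker, map_sub, map_mul, sub_eq_zero] at ha
        exact ⟨φ a, ha.symm⟩
    have hdim' : ringKrullDim ((B ⧸ Ideal.span {φ H}) ⧸ J'.map φ') + (r : WithBot ℕ∞) = m := by
      have e : ((B ⧸ Ideal.span {φ H}) ⧸ J'.map φ') ≃+*
          B ⧸ (Ideal.span (Set.range F)).map φ :=
        (Ideal.quotEquivOfEq (by rw [hφ', Ideal.map_map])).trans
          ((DoubleQuot.quotQuotEquivQuotSup (Ideal.span {φ H}) (J'.map φ)).trans
            (Ideal.quotEquivOfEq (by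
              rw [hJH, Ideal.map_sup, Ideal.map_span φ {H}, Set.image_singleton])))
      rw [ringKrullDim_eq_of_ringEquiv e, hd]
      exact_mod_cast (show d + r = m by lia)
    have IH := ih φ' (Ideal.Quotient.mk_surjective.comp hφ) ψ' hfin' hflat' (F ∘ Fin.succ) hdim'
    rintro z ⟨hzN, hzJ⟩
    rw [SetLike.mem_coe, hJH] at hzJ
    obtain ⟨_, hy, j, hj, rfl⟩ := Submodule.mem_sup.1 hzJ
    obtain ⟨a, rfl⟩ := Ideal.mem_span_singleton'.1 hy
    have hjker : j ∈ RingHom.ker φ' := (hker j).2 ⟨-a, by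
      rw [show j - -a * H = a * H + j by ring]; exact hzN⟩
    have hle : RingHom.ker φ' * J' ≤ RingHom.ker φ * J' ⊔ Ideal.span {H} * J' := by
      rw [← Ideal.sup_mul]
      refine Ideal.mul_mono_left fun x hx => ?_
      obtain ⟨b, hb⟩ := (hker x).1 hx
      rw [← sub_add_cancel x (b * H)]
      exact Submodule.add_mem_sup hb (Ideal.mul_mem_left _ _ (Ideal.mem_span_singleton_self _))
    obtain ⟨u, hu, _, hv, rfl⟩ := Submodule.mem_sup.1 (hle (IH ⟨hjker, hj⟩))
    obtain ⟨d, hdJ, rfl⟩ := Ideal.mem_span_singleton_mul.1 hv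
    have huN : u ∈ RingHom.ker φ := Ideal.mul_le_left hu
    -- Now `z = a H + j` with `j = u + H d`, `u ∈ ker φ * J'` and `d ∈ J'`. So `(a + d) H = z - u`
    -- lies in `ker φ`, and `H` can be cancelled modulo `ker φ`.
    have hadN : a + d ∈ RingHom.ker φ := by
      have h1 : (a + d) * H ∈ RingHom.ker φ := by
        rw [show (a + d) * H = a * H + (u + H * d) - u by ring]
        exact Ideal.sub_mem _ hzN huN
      rw [RingHom.mem_ker, map_mul] at h1
      exact (mem_nonZeroDivisors_iff_right.1 hreg) _ h1
    rw [show a * H + (u + H * d) = u + (a + d) * H by ring, hJH, Ideal.mul_sup]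
    exact Ideal.add_mem _ (Ideal.mem_sup_right hu)
      (Ideal.mem_sup_left (Ideal.mul_mem_mul hadN (Ideal.mem_span_singleton_self _)))

/-! ### The ring `R⟨x⟩`: completeness, reduction, and the equality case -/

noncomputable section

namespace Strassmann

open MvPowerSeries Filter Topology

variable {K : Type*} [NormedField K] [IsUltrametricDist K] {n : ℕ}

theorem norm_le_one (a : RingOfIntegers K) : ‖a‖ ≤ 1 := a.2

theorem norm_mul_ringOfIntegers (a b : RingOfIntegers K) : ‖a * b‖ = ‖a‖ * ‖b‖ :=
  norm_mul (a : K) (b : K)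

theorem norm_pow_ringOfIntegers (a : RingOfIntegers K) (m : ℕ) : ‖a ^ m‖ = ‖a‖ ^ m :=
  norm_pow (a : K) m

theorem norm_pos_ringOfIntegers {a : RingOfIntegers K} (ha : a ≠ 0) : 0 < ‖a‖ :=
  norm_pos_iff.2 ha

theorem dvd_iff_norm_le {a b : RingOfIntegers K} (ha : a ≠ 0) : a ∣ b ↔ ‖b‖ ≤ ‖a‖ := by
  constructor
  · rintro ⟨c, rfl⟩
    rw [norm_mul_ringOfIntegers]
    exact mul_le_of_le_one_right (norm_nonneg _) (norm_le_one c)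
  · intro h
    have ha' : (a : K) ≠ 0 := fun h0 => ha (Subtype.ext h0)
    have hc : ‖(b : K) / a‖ ≤ 1 := by
      rw [norm_div]
      exact div_le_one_of_le₀ h (norm_nonneg _)
    refine ⟨⟨(b : K) / a, hc⟩, Subtype.ext ?_⟩
    change (b : K) = a * (b / a)
    field_simp

variable {ϖ : RingOfIntegers K}

theorem norm_uniformizer_lt_one
    (hϖ : IsLocalRing.maximalIdeal (RingOfIntegers K) = Ideal.span {ϖ}) : ‖ϖ‖ < 1 := by
  have h : ϖ ∈ IsLocalRing.maximalIdeal (RingOfIntegers K) :=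
    hϖ ▸ Ideal.mem_span_singleton_self ϖ
  exact (Valuation.mem_maximalIdeal_iff (v := NormedField.valuation (K := K))).1 h

theorem residue_eq_zero_iff_dvd
    (hϖ : IsLocalRing.maximalIdeal (RingOfIntegers K) = Ideal.span {ϖ}) {a : RingOfIntegers K} :
    IsLocalRing.residue (RingOfIntegers K) a = 0 ↔ ϖ ∣ a := by
  rw [IsLocalRing.residue_eq_zero_iff, hϖ, Ideal.mem_span_singleton]

theorem uniformizer_ne_zero {K : Type*} [NontriviallyNormedField K] [IsUltrametricDist K]
    {ϖ : RingOfIntegers K}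
    (hϖ : IsLocalRing.maximalIdeal (RingOfIntegers K) = Ideal.span {ϖ}) : ϖ ≠ 0 := by
  rintro rfl
  obtain ⟨x, hx0, hx1⟩ := NormedField.exists_norm_lt_one K
  have h := (residue_eq_zero_iff_dvd hϖ).1
    (residue_eq_zero_of_norm_lt_one (a := ⟨x, hx1.le⟩) hx1)
  rw [zero_dvd_iff] at h
  exact norm_pos_iff.1 hx0 (congrArg Subtype.val h)

theorem exists_dvd_pow (h1 : ‖ϖ‖ < 1) {a : RingOfIntegers K} (ha : a ≠ 0) :
    ∃ m : ℕ, a ∣ ϖ ^ m := by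
  obtain ⟨m, hm⟩ := exists_pow_lt_of_lt_one (norm_pos_ringOfIntegers ha) h1
  exact ⟨m, (dvd_iff_norm_le ha).2 (by rw [norm_pow_ringOfIntegers]; exact hm.le)⟩

theorem pow_dvd_iff_norm_le (h0 : ϖ ≠ 0) {m : ℕ} {a : RingOfIntegers K} :
    ϖ ^ m ∣ a ↔ ‖a‖ ≤ ‖ϖ‖ ^ m := by
  rw [dvd_iff_norm_le (pow_ne_zero m h0), norm_pow_ringOfIntegers]

theorem eq_zero_of_forall_pow_dvd (h1 : ‖ϖ‖ < 1) (h0 : ϖ ≠ 0) {a : RingOfIntegers K}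
    (h : ∀ m, ϖ ^ m ∣ a) : a = 0 := by
  refine norm_le_zero_iff.1 (ge_of_tendsto' (tendsto_pow_atTop_nhds_zero_of_lt_one
    (norm_nonneg ϖ) h1) fun m => (pow_dvd_iff_norm_le h0).1 (h m))

theorem _root_.SModEq.span_singleton_pow_iff {R : Type*} [CommRing R] {π x y : R} {m : ℕ} :
    x ≡ y [SMOD (Ideal.span {π} ^ m • ⊤ : Submodule R R)] ↔ π ^ m ∣ x - y := by
  rw [SModEq.sub_mem, smul_eq_mul, Ideal.mul_top, Ideal.span_singleton_pow,
    Ideal.mem_span_singleton]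

theorem isAdicComplete_ringOfIntegers [CompleteSpace K] (h1 : ‖ϖ‖ < 1) (h0 : ϖ ≠ 0) :
    IsAdicComplete (Ideal.span {ϖ}) (RingOfIntegers K) where
  haus' x hx := eq_zero_of_forall_pow_dvd h1 h0 fun m => by
    have := hx m
    rwa [SModEq.span_singleton_pow_iff, sub_zero] at this
  prec' f hf := by
    have hf' : ∀ {m l}, m ≤ l → ‖(f l : K) - f m‖ ≤ ‖ϖ‖ ^ m := fun {m l} hml => by
      have := (pow_dvd_iff_norm_le h0).1 (SModEq.span_singleton_pow_iff.1 (hf hml).symm)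
      exact this
    have hlim := tendsto_pow_atTop_nhds_zero_of_lt_one (norm_nonneg ϖ) h1
    have hc : CauchySeq fun m => (f m : K) := by
      refine cauchySeq_of_le_tendsto_0 (fun m => ‖ϖ‖ ^ m + ‖ϖ‖ ^ m) (fun l m N hl hm => ?_)
        (by simpa using hlim.add hlim)
      refine (dist_triangle_right _ _ (f N : K)).trans (add_le_add ?_ ?_)
      · rw [dist_eq_norm]; exact hf' hl
      · rw [dist_eq_norm]; exact hf' hm
    obtain ⟨L, hL⟩ := cauchySeq_tendsto_of_complete hc
    have hL1 : ‖L‖ ≤ 1 := le_of_tendsto' hL.norm fun m => norm_le_one (f m)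
    refine ⟨⟨L, hL1⟩, fun m => ?_⟩
    refine SModEq.symm (SModEq.span_singleton_pow_iff.2 ((pow_dvd_iff_norm_le h0).2 ?_))
    exact le_of_tendsto (hL.sub_const (f m : K)).norm (eventually_atTop.2 ⟨m, fun l hl => hf' hl⟩)

theorem mem_integralTate {f : MvPowerSeries (Fin n) (RingOfIntegers K)} :
    f ∈ IntegralTate K n ↔ Tendsto (fun t => ‖coeff t f‖) cofinite (𝓝 0) := by
  change Tendsto _ _ _ ↔ _
  simp [Finsupp.prod]

theorem tendsto_norm_coeff (f : IntegralTate K n) :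
    Tendsto (fun t => ‖coeff t f.1‖) cofinite (𝓝 0) := mem_integralTate.1 f.2

theorem coeff_const_mul (a : RingOfIntegers K) (f : IntegralTate K n) (t : Fin n →₀ ℕ) :
    coeff t (const K n a * f).1 = a * coeff t f.1 := by
  change coeff t (C a * f.1) = _
  rw [coeff_C_mul]

theorem coeff_reduction (f : IntegralTate K n) (t : Fin n →₀ ℕ) :
    MvPolynomial.coeff t (reduction K n f) =
      IsLocalRing.residue (RingOfIntegers K) (coeff t f.1) := by
  have := congrArg (coeff t) (coe_reductionFun f)
  rwa [MvPolynomial.coeff_coe, coeff_map] at this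

/-- Dividing all coefficients by a fixed `a ≠ 0` rescales their norms by a constant, so convergence
is preserved. -/
theorem const_dvd_iff {a : RingOfIntegers K} (ha : a ≠ 0) {f : IntegralTate K n} :
    const K n a ∣ f ↔ ∀ t, a ∣ coeff t f.1 := by
  constructor
  · rintro ⟨g, rfl⟩ t
    exact ⟨_, coeff_const_mul a g t⟩
  · intro h
    choose g hg using h
    have hpos := norm_pos_ringOfIntegers ha
    refine ⟨⟨fun t => g t, mem_integralTate.2 ?_⟩, Subtype.ext (MvPowerSeries.ext fun t => ?_)⟩
    · have : ∀ t, ‖g t‖ = ‖a‖⁻¹ * ‖coeff t f.1‖ := fun t => by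
        rw [hg t, norm_mul_ringOfIntegers, inv_mul_cancel_left₀ hpos.ne']
      change Tendsto (fun t => ‖g t‖) _ _
      simp only [this]
      simpa using (tendsto_norm_coeff f).const_mul ‖a‖⁻¹
    · rw [coeff_const_mul]
      exact hg t

theorem const_pow_dvd_iff (h0 : ϖ ≠ 0) {m : ℕ} {f : IntegralTate K n} :
    const K n ϖ ^ m ∣ f ↔ ∀ t, ϖ ^ m ∣ coeff t f.1 := by
  rw [← map_pow, const_dvd_iff (pow_ne_zero m h0)]

theorem ker_reduction (hϖ : IsLocalRing.maximalIdeal (RingOfIntegers K) = Ideal.span {ϖ})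
    (h0 : ϖ ≠ 0) : RingHom.ker (reduction K n) = Ideal.span {const K n ϖ} := by
  ext f
  rw [RingHom.mem_ker, Ideal.mem_span_singleton, const_dvd_iff h0, MvPolynomial.ext_iff]
  simp only [coeff_reduction, MvPolynomial.coeff_zero, residue_eq_zero_iff_dvd hϖ]

theorem reduction_surjective : Function.Surjective (reduction K n) := by
  intro q
  choose l hl using IsLocalRing.residue_surjective (R := RingOfIntegers K)
  refine ⟨⟨fun t => if t ∈ q.support then l (q.coeff t) else 0, mem_integralTate.2 ?_⟩, ?_⟩
  · refine tendsto_nhds_of_eventually_eq (eventually_cofinite.2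
      ((Finset.finite_toSet q.support).subset fun t ht => ?_))
    by_contra htq
    exact ht (by
      change ‖ite _ _ _‖ = _
      rw [if_neg (Finset.mem_coe.not.1 htq), norm_zero])
  · ext t
    rw [coeff_reduction]
    change IsLocalRing.residue _ (ite _ _ _) = _
    split_ifs with h
    · exact hl _
    · rw [map_zero, MvPolynomial.notMem_support_iff.1 h]

theorem isAdicComplete_integralTate [CompleteSpace K] (h1 : ‖ϖ‖ < 1) (h0 : ϖ ≠ 0) :
    IsAdicComplete (Ideal.span {const K n ϖ}) (IntegralTate K n) where
  haus' f hf := by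
    refine Subtype.ext (MvPowerSeries.ext fun t => ?_)
    refine eq_zero_of_forall_pow_dvd h1 h0 fun m => ?_
    have := hf m
    rw [SModEq.span_singleton_pow_iff, sub_zero, const_pow_dvd_iff h0] at this
    exact this t
  prec' f hf := by
    have := isAdicComplete_ringOfIntegers h1 h0
    have hf' : ∀ {m l}, m ≤ l → ∀ t, ϖ ^ m ∣ coeff t (f m).1 - coeff t (f l).1 :=
      fun {m l} hml t => by
        have := (const_pow_dvd_iff h0).1 (SModEq.span_singleton_pow_iff.1 (hf hml)) t
        rw [← map_sub]
        exact this
    choose L hL using fun t => IsPrecomplete.prec (I := Ideal.span {ϖ}) inferInstance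
      (f := fun m => coeff t (f m).1) fun hml => SModEq.span_singleton_pow_iff.2 (hf' hml t)
    have hL' : ∀ m t, ϖ ^ m ∣ coeff t (f m).1 - L t := fun m t =>
      SModEq.span_singleton_pow_iff.1 (hL t m)
    refine ⟨⟨fun t => L t, mem_integralTate.2 ?_⟩, fun m => ?_⟩
    · change Tendsto (fun t => ‖L t‖) _ _
      rw [NormedAddGroup.tendsto_nhds_zero]
      intro ε hε
      obtain ⟨m, hm⟩ := exists_pow_lt_of_lt_one (half_pos hε) h1
      have hev := (tendsto_norm_coeff (f m)).eventually (gt_mem_nhds (half_pos hε))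
      filter_upwards [hev] with t ht
      rw [norm_norm]
      have h2 := (pow_dvd_iff_norm_le h0).1 (hL' m t)
      calc ‖L t‖ = ‖coeff t (f m).1 - (coeff t (f m).1 - L t)‖ := by rw [sub_sub_cancel]
        _ ≤ ‖coeff t (f m).1‖ + ‖coeff t (f m).1 - L t‖ := norm_sub_le _ _
        _ < ε / 2 + ε / 2 := add_lt_add ht (h2.trans_lt hm)
        _ = ε := add_halves ε
    · refine SModEq.span_singleton_pow_iff.2 ((const_pow_dvd_iff h0).2 fun t => ?_)
      exact hL' m t

theorem isNoetherianRing_integralTate [CompleteSpace K]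
    (hϖ : IsLocalRing.maximalIdeal (RingOfIntegers K) = Ideal.span {ϖ}) (h0 : ϖ ≠ 0) :
    IsNoetherianRing (IntegralTate K n) := by
  have := isAdicComplete_integralTate (n := n) (norm_uniformizer_lt_one hϖ) h0
  have : IsNoetherianRing (IntegralTate K n ⧸ Ideal.span {const K n ϖ}) :=
    isNoetherianRing_of_ringEquiv (MvPolynomial (Fin n) (ResField K))
      ((RingHom.quotientKerEquivOfSurjective reduction_surjective).symm.trans
        (Ideal.quotEquivOfEq (ker_reduction hϖ h0)))
  exact IsNoetherianRing.of_isAdicComplete_span_singleton (const K n ϖ)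

theorem const_injective : Function.Injective (const K n) := fun _ _ h =>
  C_injective (congrArg Subtype.val h)

theorem reduction_const (a : RingOfIntegers K) :
    reduction K n (const K n a) = MvPolynomial.C (IsLocalRing.residue _ a) := by
  classical
  ext t
  rw [coeff_reduction, MvPolynomial.coeff_C]
  change IsLocalRing.residue _ (coeff t (C a)) = _
  rw [coeff_C]
  simp only [eq_comm (a := t)]
  split_ifs
  · rfl
  · exact map_zero _

/-- An ideal with `r` generators whose reduction has codimension `r` is saturated. -/
theorem mem_of_const_mul_mem
    (hϖ : IsLocalRing.maximalIdeal (RingOfIntegers K) = Ideal.span {ϖ}) (h0 : ϖ ≠ 0) {r : ℕ}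
    {J : Ideal (IntegralTate K n)} (hJ : GeneratedBy J r)
    (hdim : dimReduction J + (r : WithBot ℕ∞) = (n : WithBot ℕ∞)) {g : IntegralTate K n}
    (hg : const K n ϖ * g ∈ J) : g ∈ J := by
  obtain ⟨F, rfl⟩ := hJ
  -- Here `B = k[x]`, finite and flat over itself, and the kernel is `(ϖ)`; the result reads `(ϖ) ∩
  -- J ≤ ϖJ`.
  have h := Ideal.ker_inf_le_ker_mul_of_finite_of_flat r (reduction K n) reduction_surjective
    (RingHom.id _) (RingHom.Finite.id _) (RingHom.Flat.id _) F hdim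
  rw [ker_reduction hϖ h0] at h
  obtain ⟨z, hz, hzg⟩ := Ideal.mem_span_singleton_mul.1
    (h ⟨Ideal.mul_mem_right _ _ (Ideal.mem_span_singleton_self _), hg⟩)
  have hne : const K n ϖ ≠ 0 := fun h => h0 (const_injective (h.trans (map_zero _).symm))
  rwa [← mul_left_cancel₀ hne hzg]

theorem mem_stepIdeal {I : Ideal (IntegralTate K n)} {l : ℕ} {g : IntegralTate K n} :
    g ∈ stepIdeal ϖ I l ↔ const K n (ϖ ^ l) * g ∈ I := by
  rw [stepIdeal, Submodule.mem_colon]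
  constructor
  · intro h
    simpa [mul_comm] using h _ (Ideal.mem_span_singleton_self _)
  · intro h p hp
    obtain ⟨b, rfl⟩ := Ideal.mem_span_singleton'.1 hp
    rw [smul_eq_mul, show g * (b * const K n (ϖ ^ l)) = b * (const K n (ϖ ^ l) * g) by ring]
    exact I.mul_mem_left _ h

theorem le_stepIdeal (I : Ideal (IntegralTate K n)) (l : ℕ) : I ≤ stepIdeal ϖ I l :=
  fun _ hg => mem_stepIdeal.2 (I.mul_mem_left _ hg)

theorem mem_saturation_iff (h1 : ‖ϖ‖ < 1) (h0 : ϖ ≠ 0) {I : Ideal (IntegralTate K n)}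
    {f : IntegralTate K n} : f ∈ saturation I ↔ ∃ m, const K n ϖ ^ m * f ∈ I := by
  constructor
  · rintro ⟨a, ha, haf⟩
    obtain ⟨m, b, hb⟩ := exists_dvd_pow h1 ha
    refine ⟨m, ?_⟩
    rw [← map_pow, hb, mul_comm a, map_mul, mul_assoc]
    exact I.mul_mem_left _ haf
  · rintro ⟨m, hm⟩
    exact ⟨ϖ ^ m, pow_ne_zero m h0, by rwa [map_pow]⟩

theorem stepIdeal_eq_saturation
    (hϖ : IsLocalRing.maximalIdeal (RingOfIntegers K) = Ideal.span {ϖ}) (h0 : ϖ ≠ 0) {r l : ℕ}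
    {I : Ideal (IntegralTate K n)} (hI : GeneratedBy (stepIdeal ϖ I l) r)
    (hdim : dimReduction (stepIdeal ϖ I l) + (r : WithBot ℕ∞) = (n : WithBot ℕ∞)) :
    stepIdeal ϖ I l = saturation I := by
  refine le_antisymm (fun g hg => ⟨ϖ ^ l, pow_ne_zero l h0, mem_stepIdeal.1 hg⟩) fun g hg => ?_
  obtain ⟨m, hm⟩ := (mem_saturation_iff (norm_uniformizer_lt_one hϖ) h0).1 hg
  replace hm := le_stepIdeal (ϖ := ϖ) I l hm
  clear hg
  induction m with
  | zero => simpa using hm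
  | succ m ih =>
    rw [pow_succ', mul_assoc] at hm
    exact ih (mem_of_const_mul_mem hϖ h0 hI hdim hm)

end Strassmann

end

/-! ### Expansion in some of the variables, and the lower bound for heights -/

noncomputable section

namespace Strassmann

open MvPowerSeries Filter Topology

variable {K : Type*} [NormedField K] [IsUltrametricDist K] {n : ℕ} {ϖ : RingOfIntegers K}

/-- The exponent `t` only involves variables with index in `S`. -/
def InVars (S : Set (Fin n)) (t : Fin n →₀ ℕ) : Prop := ∀ j, t j ≠ 0 → j ∈ S

theorem inVars_add {S : Set (Fin n)} {t u : Fin n →₀ ℕ} :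
    InVars S (t + u) ↔ InVars S t ∧ InVars S u := by
  simp only [InVars, Finsupp.add_apply, ← forall_and]
  refine forall_congr' fun j => ?_
  rw [Ne, Nat.add_eq_zero_iff]
  tauto

theorem inVars_zero (S : Set (Fin n)) : InVars S 0 := fun _ h => absurd rfl h

open scoped Classical in
/-- The coefficient of `y ^ e` in `f`, as a series in the variables with index in `S`; here `y`
stands for the other variables. -/
def partialCoeff (S : Set (Fin n)) (e : Fin n →₀ ℕ) (f : IntegralTate K n) : IntegralTate K n :=
  ⟨fun t => if InVars S t then coeff (t + e) f.1 else 0, mem_integralTate.2 <| by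
    refine squeeze_zero (fun t => norm_nonneg _) (fun t => ?_)
      ((tendsto_norm_coeff f).comp (add_left_injective e).tendsto_cofinite)
    change ‖ite _ _ _‖ ≤ ‖coeff (t + e) f.1‖
    split_ifs
    · exact le_rfl
    · simp⟩

open scoped Classical in
theorem coeff_partialCoeff (S : Set (Fin n)) (e : Fin n →₀ ℕ) (f : IntegralTate K n)
    (t : Fin n →₀ ℕ) :
    coeff t (partialCoeff S e f).1 = if InVars S t then coeff (t + e) f.1 else 0 := rfl

theorem integralTate_ext {f g : IntegralTate K n} (h : ∀ t, coeff t f.1 = coeff t g.1) : f = g :=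
  Subtype.ext (MvPowerSeries.ext h)

theorem coeff_coe_mul (f g : IntegralTate K n) (t : Fin n →₀ ℕ) :
    coeff t (f * g).1 = ∑ p ∈ Finset.HasAntidiagonal.antidiagonal t, coeff p.1 f.1 * coeff p.2 g.1 :=
  coeff_mul _ _ _

theorem coeff_coe_sum {ι : Type*} (s : Finset ι) (f : ι → IntegralTate K n) (t : Fin n →₀ ℕ) :
    coeff t (∑ i ∈ s, f i).1 = ∑ i ∈ s, coeff t (f i).1 := by
  rw [← map_sum]
  congr 1
  exact map_sum (IntegralTate K n).subtype f s

theorem coeff_coe_add (f g : IntegralTate K n) (t : Fin n →₀ ℕ) :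
    coeff t (f + g).1 = coeff t f.1 + coeff t g.1 := rfl

/-- Splitting exponents into their parts inside and outside `S` identifies decompositions of `t + e`
with pairs of decompositions of `e` and `t`. This makes `partialExpansion` multiplicative. -/
theorem sum_antidiagonal_add_of_inVars {M : Type*} [AddCommMonoid M] {S : Set (Fin n)}
    {t e : Fin n →₀ ℕ} (ht : InVars S t) (he : InVars Sᶜ e)
    (G : (Fin n →₀ ℕ) × (Fin n →₀ ℕ) → M) :
    ∑ p ∈ Finset.HasAntidiagonal.antidiagonal (t + e), G p =
      ∑ a ∈ Finset.HasAntidiagonal.antidiagonal e, ∑ b ∈ Finset.HasAntidiagonal.antidiagonal t, G (b.1 + a.1, b.2 + a.2) := by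
  classical
  have h1 : ∀ u : Fin n →₀ ℕ, InVars S u → u.filter (· ∈ S) = u ∧ u.filter (· ∉ S) = 0 := by
    intro u hu
    refine ⟨Finsupp.filter_eq_self_iff _ _ |>.2 hu, Finsupp.filter_eq_zero_iff _ _ |>.2 ?_⟩
    intro j hj
    by_contra h
    exact hj (hu j h)
  have h2 : ∀ u : Fin n →₀ ℕ, InVars Sᶜ u → u.filter (· ∈ S) = 0 ∧ u.filter (· ∉ S) = u := by
    intro u hu
    refine ⟨Finsupp.filter_eq_zero_iff _ _ |>.2 ?_, Finsupp.filter_eq_self_iff _ _ |>.2 hu⟩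
    intro j hj
    by_contra h
    exact hu j h hj
  rw [← Finset.sum_product']
  symm
  refine Finset.sum_nbij' (fun x => (x.2.1 + x.1.1, x.2.2 + x.1.2))
    (fun p => ((p.1.filter (· ∉ S), p.2.filter (· ∉ S)),
      (p.1.filter (· ∈ S), p.2.filter (· ∈ S)))) ?_ ?_ ?_ ?_ ?_
  · rintro ⟨⟨a, a'⟩, ⟨b, b'⟩⟩ h
    simp only [Finset.mem_product, Finset.HasAntidiagonal.mem_antidiagonal] at h ⊢
    rw [← h.1, ← h.2]; abel
  · rintro ⟨u, v⟩ h
    simp only [Finset.mem_product, Finset.HasAntidiagonal.mem_antidiagonal] at h ⊢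
    rw [← Finsupp.filter_add, ← Finsupp.filter_add, h, Finsupp.filter_add, Finsupp.filter_add,
      (h1 t ht).1, (h1 t ht).2, (h2 e he).1, (h2 e he).2]
    simp
  · rintro ⟨⟨a, a'⟩, ⟨b, b'⟩⟩ h
    simp only [Finset.mem_product, Finset.HasAntidiagonal.mem_antidiagonal] at h
    rw [← h.1, inVars_add] at he
    rw [← h.2, inVars_add] at ht
    simp only [Finsupp.filter_add, (h1 b ht.1).1, (h1 b ht.1).2, (h1 b' ht.2).1, (h1 b' ht.2).2,
      (h2 a he.1).1, (h2 a he.1).2, (h2 a' he.2).1, (h2 a' he.2).2, zero_add, add_zero]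
  · rintro ⟨u, v⟩ _
    simp only [Finsupp.filter_add_filter_not]
  · intro _ _
    rfl

theorem partialCoeff_mul {S : Set (Fin n)} {e : Fin n →₀ ℕ} (he : InVars Sᶜ e)
    (f g : IntegralTate K n) : partialCoeff S e (f * g) =
      ∑ p ∈ Finset.HasAntidiagonal.antidiagonal e, partialCoeff S p.1 f * partialCoeff S p.2 g := by
  classical
  refine integralTate_ext fun t => ?_
  rw [coeff_partialCoeff, coeff_coe_sum]
  simp only [coeff_coe_mul, coeff_partialCoeff]
  split_ifs with ht
  · rw [sum_antidiagonal_add_of_inVars ht he]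
    refine Finset.sum_congr rfl fun a _ => Finset.sum_congr rfl fun b hb => ?_
    rw [← Finset.HasAntidiagonal.mem_antidiagonal.1 hb, inVars_add] at ht
    rw [if_pos ht.1, if_pos ht.2]
  · symm
    refine Finset.sum_eq_zero fun a _ => Finset.sum_eq_zero fun b hb => ?_
    rw [← Finset.HasAntidiagonal.mem_antidiagonal.1 hb, inVars_add, not_and_or] at ht
    rcases ht with h | h
    · rw [if_neg h, zero_mul]
    · rw [if_neg h, mul_zero]

theorem partialCoeff_add (S : Set (Fin n)) (e : Fin n →₀ ℕ) (f g : IntegralTate K n) :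
    partialCoeff S e (f + g) = partialCoeff S e f + partialCoeff S e g := by
  classical
  refine integralTate_ext fun t => ?_
  simp only [coeff_coe_add, coeff_partialCoeff]
  split_ifs <;> simp

theorem partialCoeff_zero_right (S : Set (Fin n)) (e : Fin n →₀ ℕ) :
    partialCoeff S e (0 : IntegralTate K n) = 0 := by
  classical
  refine integralTate_ext fun t => ?_
  rw [coeff_partialCoeff]
  exact ite_self _

open scoped Classical in
theorem partialCoeff_one (S : Set (Fin n)) (e : Fin n →₀ ℕ) :
    partialCoeff S e (1 : IntegralTate K n) = if e = 0 then 1 else 0 := by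
  refine integralTate_ext fun t => ?_
  rw [coeff_partialCoeff]
  change ite _ (coeff (t + e) (1 : MvPowerSeries (Fin n) (RingOfIntegers K))) 0 = _
  rw [coeff_one]
  split_ifs with h1 h2 h3 h3
  · change _ = coeff t (1 : MvPowerSeries (Fin n) (RingOfIntegers K))
    rw [coeff_one, if_pos (add_eq_zero.1 h2).1]
  · exact absurd (add_eq_zero.1 h2).2 h3
  · change _ = coeff t (1 : MvPowerSeries (Fin n) (RingOfIntegers K))
    rw [coeff_one, if_neg fun ht => h2 (by rw [ht, h3, add_zero])]
  · rfl
  · change _ = coeff t (1 : MvPowerSeries (Fin n) (RingOfIntegers K))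
    rw [coeff_one, if_neg fun ht => h1 (by rw [ht]; exact inVars_zero S)]
  · rfl

open scoped Classical in
/-- The underlying function of `partialExpansion`. -/
def partialExpansionFun (S : Set (Fin n)) (P : Ideal (IntegralTate K n)) (f : IntegralTate K n) :
    MvPowerSeries (Fin n) (IntegralTate K n ⧸ P) :=
  fun e => if InVars Sᶜ e then Ideal.Quotient.mk P (partialCoeff S e f) else 0

open scoped Classical in
theorem coeff_partialExpansionFun (S : Set (Fin n)) (P : Ideal (IntegralTate K n))
    (f : IntegralTate K n) (e : Fin n →₀ ℕ) : coeff e (partialExpansionFun S P f) =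
      if InVars Sᶜ e then Ideal.Quotient.mk P (partialCoeff S e f) else 0 := rfl

/-- Expansion with respect to the variables with index outside `S`, the coefficients being reduced
modulo the ideal `P`. -/
def partialExpansion (S : Set (Fin n)) (P : Ideal (IntegralTate K n)) :
    IntegralTate K n →+* MvPowerSeries (Fin n) (IntegralTate K n ⧸ P) where
  toFun := partialExpansionFun S P
  map_zero' := by
    ext e
    rw [coeff_partialExpansionFun, partialCoeff_zero_right, map_zero, ite_self, map_zero]
  map_one' := by
    classical
    ext e
    rw [coeff_partialExpansionFun, partialCoeff_one, coeff_one]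
    split_ifs with h1 h2 h2
    · exact map_one _
    · exact map_zero _
    · exact absurd (by rw [h2]; exact inVars_zero _) h1
    · rfl
  map_add' f g := by
    ext e
    rw [map_add]
    simp only [coeff_partialExpansionFun, partialCoeff_add, map_add]
    split_ifs <;> simp
  map_mul' f g := by
    classical
    ext e
    rw [coeff_mul]
    simp only [coeff_partialExpansionFun]
    split_ifs with he
    · rw [partialCoeff_mul he, map_sum]
      refine Finset.sum_congr rfl fun p hp => ?_
      rw [← Finset.HasAntidiagonal.mem_antidiagonal.1 hp, inVars_add] at he
      rw [if_pos he.1, if_pos he.2, map_mul]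
    · symm
      refine Finset.sum_eq_zero fun p hp => ?_
      rw [← Finset.HasAntidiagonal.mem_antidiagonal.1 hp, inVars_add, not_and_or] at he
      rcases he with h | h
      · rw [if_neg h, zero_mul]
      · rw [if_neg h, mul_zero]

theorem mem_ker_partialExpansion {S : Set (Fin n)} {P : Ideal (IntegralTate K n)}
    {f : IntegralTate K n} :
    f ∈ RingHom.ker (partialExpansion S P) ↔ ∀ e, InVars Sᶜ e → partialCoeff S e f ∈ P := by
  classical
  rw [RingHom.mem_ker, MvPowerSeries.ext_iff]
  refine forall_congr' fun e => ?_
  change ite _ _ _ = (0 : IntegralTate K n ⧸ P) ↔ _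
  split_ifs with h
  · rw [Ideal.Quotient.eq_zero_iff_mem]
    exact ⟨fun h _ => h, fun h' => h' h⟩
  · exact ⟨fun _ h' => absurd h' h, fun _ => rfl⟩

/-- Power series over the domain `R⟨x⟩ ⧸ P` form a domain. -/
instance isPrime_ker_partialExpansion (S : Set (Fin n)) (P : Ideal (IntegralTate K n))
    [P.IsPrime] : (RingHom.ker (partialExpansion S P)).IsPrime :=
  have : IsDomain (MvPowerSeries (Fin n) (IntegralTate K n ⧸ P)) := NoZeroDivisors.to_isDomain _
  RingHom.ker_isPrime _

theorem ker_partialExpansion_univ (P : Ideal (IntegralTate K n)) :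
    RingHom.ker (partialExpansion Set.univ P) = P := by
  classical
  have h0 : ∀ f : IntegralTate K n, partialCoeff Set.univ 0 f = f := fun f =>
    integralTate_ext fun t => by
      rw [coeff_partialCoeff, if_pos (show InVars Set.univ t from fun _ _ => Set.mem_univ _), add_zero]
  ext f
  rw [mem_ker_partialExpansion]
  constructor
  · intro h
    simpa [h0] using h 0 (inVars_zero _)
  · intro h e he
    have : e = 0 := Finsupp.ext fun j => by
      by_contra hj
      exact he j hj (Set.mem_univ j)
    rwa [this, h0]

/-- The variables of `R⟨x₁, …, xₙ⟩`. -/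
def var (K : Type*) [NormedField K] [IsUltrametricDist K] {n : ℕ} (i : Fin n) :
    IntegralTate K n :=
  ⟨X i, isRestricted_monomial _ _ _⟩

open scoped Classical in
theorem coeff_mul_var_pow (f : IntegralTate K n) (i : Fin n) (m : ℕ) (t : Fin n →₀ ℕ) :
    coeff t (f * var K i ^ m).1 =
      if m ≤ t i then coeff (t - Finsupp.single i m) f.1 else 0 := by
  change coeff t (f.1 * X i ^ m) = _
  rw [X_pow_eq, coeff_mul_monomial]
  simp [Finsupp.single_le_iff]

theorem exists_forall_pow_dvd_coeff (h0 : ϖ ≠ 0) (f : IntegralTate K n) (N : ℕ) (i : Fin n) :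
    ∃ m : ℕ, ∀ t : Fin n →₀ ℕ, m ≤ t i → ϖ ^ N ∣ coeff t f.1 := by
  have hfin := eventually_cofinite.1 ((tendsto_norm_coeff f).eventually
    (ge_mem_nhds (pow_pos (norm_pos_ringOfIntegers h0) N)))
  refine ⟨hfin.toFinset.sup (fun t => t i) + 1, fun t ht => ?_⟩
  rw [pow_dvd_iff_norm_le h0]
  by_contra hcon
  have := Finset.le_sup (f := fun t : Fin n →₀ ℕ => t i) ((Set.Finite.mem_toFinset hfin).2 hcon)
  lia

/-- A coefficient relative to `insert i S` is the convergent sum of the coefficients relative to `S`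
times powers of `x_i`. The latter lie in `P`, and `P` is `ϖ`-adically closed. -/
theorem ker_partialExpansion_le_insert (h0 : ϖ ≠ 0) {P : Ideal (IntegralTate K n)}
    (hP : ∀ f, (∀ N, ∃ y, f - const K n ϖ ^ N * y ∈ P) → f ∈ P) {S : Set (Fin n)} {i : Fin n}
    (hi : i ∉ S) :
    RingHom.ker (partialExpansion S P) ≤ RingHom.ker (partialExpansion (insert i S) P) := by
  classical
  intro f hf
  rw [mem_ker_partialExpansion] at hf ⊢
  intro e he
  refine hP _ fun N => ?_
  obtain ⟨m, hm⟩ := exists_forall_pow_dvd_coeff h0 f N i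
  have hsec : ∑ j ∈ Finset.range m, partialCoeff S (e + Finsupp.single i j) f * var K i ^ j ∈ P := by
    refine P.sum_mem fun j _ => P.mul_mem_right _ (hf _ (inVars_add.2 ⟨fun a ha has => ?_, ?_⟩))
    · exact he a ha (Set.mem_insert_of_mem i has)
    · intro a ha
      rw [Finsupp.single_apply] at ha
      split_ifs at ha with hia
      · exact hia ▸ hi
      · exact absurd rfl ha
  have hdvd : const K n ϖ ^ N ∣ partialCoeff (insert i S) e f -
      ∑ j ∈ Finset.range m, partialCoeff S (e + Finsupp.single i j) f * var K i ^ j := by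
    rw [const_pow_dvd_iff h0]
    intro t
    change _ ∣ coeff t (partialCoeff (insert i S) e f).1 - coeff t (Subtype.val (∑ j ∈ Finset.range m,
      partialCoeff S (e + Finsupp.single i j) f * var K i ^ j))
    rw [coeff_coe_sum]
    simp only [coeff_mul_var_pow, coeff_partialCoeff]
    -- As `i ∉ S`, the exponent `t - single i j` involves only `S` when `j = t i` exactly, so each
    -- sum has at most one non-zero term.
    have hterm : ∀ j, (if j ≤ t i then (if InVars S (t - Finsupp.single i j) then
        coeff (t - Finsupp.single i j + (e + Finsupp.single i j)) f.1 else 0) else 0) =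
        if j = t i then (if InVars (insert i S) t then coeff (t + e) f.1 else 0) else 0 := by
      intro j
      by_cases hj : j ≤ t i
      · rw [if_pos hj]
        have hsub : t - Finsupp.single i j + (e + Finsupp.single i j) = t + e := by
          rw [add_comm e, ← add_assoc, tsub_add_cancel_of_le (Finsupp.single_le_iff.2 hj)]
        rw [hsub]
        have hiff : InVars S (t - Finsupp.single i j) ↔ j = t i ∧ InVars (insert i S) t := by
          constructor
          · intro h
            have hji : j = t i := by
              by_contra hne
              refine hi (h i ?_)
              rw [Finsupp.tsub_apply, Finsupp.single_eq_same]
              lia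
            refine ⟨hji, fun a ha => ?_⟩
            by_cases hai : a = i
            · exact Or.inl hai
            · refine Or.inr (h a ?_)
              rwa [Finsupp.tsub_apply, Finsupp.single_eq_of_ne hai, tsub_zero]
          · rintro ⟨hji, h⟩ a ha
            rw [Finsupp.tsub_apply] at ha
            by_cases hai : a = i
            · subst hai
              rw [Finsupp.single_eq_same, hji, tsub_self] at ha
              exact absurd rfl ha
            · rw [Finsupp.single_eq_of_ne hai, tsub_zero] at ha
              exact (h a ha).resolve_left hai
        rw [hiff]
        by_cases h1 : j = t i <;> by_cases h2 : InVars (insert i S) t <;> simp [h1, h2]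
      · rw [if_neg hj, if_neg fun h => hj h.le]
    simp only [hterm, Finset.sum_ite_eq', Finset.mem_range]
    by_cases htm : t i < m
    · rw [if_pos htm, sub_self]
      exact dvd_zero _
    · rw [if_neg htm, sub_zero]
      split_ifs
      · exact hm _ (by rw [Finsupp.add_apply]; lia)
      · exact dvd_zero _
  obtain ⟨y, hy⟩ := hdvd
  refine ⟨y, ?_⟩
  rwa [← hy, sub_sub_cancel]

theorem coeff_eval₂_var (q : Polynomial (RingOfIntegers K)) (i : Fin n) (t : Fin n →₀ ℕ) :
    coeff t (q.eval₂ (const K n) (var K i)).1 =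
      if t = Finsupp.single i (t i) then q.coeff (t i) else 0 := by
  classical
  rw [Polynomial.eval₂_eq_sum_range, coeff_coe_sum]
  have hterm : ∀ j, coeff t (const K n (q.coeff j) * var K i ^ j).1 =
      if t = Finsupp.single i j then q.coeff j else 0 := fun j => by
    rw [coeff_const_mul]
    change _ * coeff t (X i ^ j) = _
    rw [coeff_X_pow, mul_ite, mul_one, mul_zero]
  simp only [hterm]
  split_ifs with h
  · rw [Finset.sum_eq_single (t i)]
    · rw [if_pos h]
    · intro j _ hj
      rw [if_neg]
      rintro rfl
      exact hj (by simp)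
    · intro hj
      rw [if_pos h]
      exact Polynomial.coeff_eq_zero_of_natDegree_lt (by simpa using hj)
  · refine Finset.sum_eq_zero fun j _ => if_neg ?_
    rintro rfl
    exact h (by simp)

/-- Strictness is witnessed by `q(x_i)`. With `x_i` among the coefficient variables it is a constant
lying in `P`. With `x_i` free, its coefficient at `x_i ^ natDegree q` is `1`, which is not in `P`.
-/
theorem ker_partialExpansion_lt_insert (h0 : ϖ ≠ 0) {P : Ideal (IntegralTate K n)} [P.IsPrime]
    (hP : ∀ f, (∀ N, ∃ y, f - const K n ϖ ^ N * y ∈ P) → f ∈ P) {S : Set (Fin n)} {i : Fin n}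
    (hi : i ∉ S) {q : Polynomial (RingOfIntegers K)} (hq : q.Monic)
    (hqP : q.eval₂ (const K n) (var K i) ∈ P) :
    RingHom.ker (partialExpansion S P) < RingHom.ker (partialExpansion (insert i S) P) := by
  classical
  refine lt_of_le_not_ge (ker_partialExpansion_le_insert h0 hP hi) fun hle => ?_
  have hmem : q.eval₂ (const K n) (var K i) ∈ RingHom.ker (partialExpansion (insert i S) P) := by
    rw [mem_ker_partialExpansion]
    intro e he
    by_cases he0 : e = 0
    · convert hqP using 1
      refine integralTate_ext fun t => ?_
      rw [coeff_partialCoeff, he0, add_zero, coeff_eval₂_var]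
      split_ifs with h1 h2 h2
      · rfl
      · rfl
      · refine absurd (fun j hj => ?_) h1
        rw [h2, Finsupp.single_apply] at hj
        split_ifs at hj with hij
        · exact Or.inl hij.symm
        · exact absurd rfl hj
      · rfl
    · convert P.zero_mem using 1
      refine integralTate_ext fun t => ?_
      rw [coeff_partialCoeff, coeff_eval₂_var]
      have : t + e ≠ Finsupp.single i ((t + e) i) := fun h => by
        obtain ⟨j, hj⟩ := Finsupp.ne_iff.1 he0
        have hji : j ≠ i := fun hji => he j hj (Or.inl hji)
        have := DFunLike.congr_fun h j
        rw [Finsupp.single_eq_of_ne hji, Finsupp.add_apply] at this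
        exact hj (by rw [Finsupp.zero_apply]; lia)
      rw [if_neg this, ite_self]
      rfl
  have h1 := mem_ker_partialExpansion.1 (hle hmem) (Finsupp.single i q.natDegree) (by
    intro a ha
    rw [Finsupp.single_apply] at ha
    split_ifs at ha with hia
    · exact hia ▸ hi
    · exact absurd rfl ha)
  have h2 : partialCoeff S (Finsupp.single i q.natDegree) (q.eval₂ (const K n) (var K i)) = 1 := by
    refine integralTate_ext fun t => ?_
    rw [coeff_partialCoeff, coeff_eval₂_var]
    change _ = coeff t (1 : MvPowerSeries (Fin n) (RingOfIntegers K))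
    rw [coeff_one]
    by_cases ht : t = 0
    · subst ht
      rw [if_pos (inVars_zero S), if_pos rfl, zero_add, if_pos (by simp)]
      simpa using hq.coeff_natDegree
    · rw [if_neg ht]
      split_ifs with hS hti
      · refine absurd (Finsupp.ext fun j => ?_) ht
        have hti0 : t i = 0 := by
          by_contra h
          exact hi (hS i h)
        have := DFunLike.congr_fun hti j
        rw [Finsupp.add_apply, Finsupp.add_apply, Finsupp.single_eq_same, hti0, zero_add] at this
        rw [Finsupp.zero_apply]
        lia
      · rfl
      · rfl
  rw [h2] at h1
  exact Ideal.IsPrime.ne_top' ((Ideal.eq_top_iff_one P).2 h1)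

/-- A closed prime ideal `P` such that every variable is integral over `R` modulo `P` has height at
least `n`. -/
theorem natCast_le_height [IsNoetherianRing (IntegralTate K n)] (h0 : ϖ ≠ 0)
    {P : Ideal (IntegralTate K n)} [P.IsPrime]
    (hP : ∀ f, (∀ N, ∃ y, f - const K n ϖ ^ N * y ∈ P) → f ∈ P)
    (hint : ∀ i, ∃ q : Polynomial (RingOfIntegers K), q.Monic ∧
      q.eval₂ (const K n) (var K i) ∈ P) : (n : ℕ∞) ≤ P.height := by
  -- The chain moves the variables one by one into the coefficient ring; after all `n` of them the
  -- kernel is `P` itself.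
  have key : ∀ m : ℕ, m ≤ n →
      (m : ℕ∞) ≤ (RingHom.ker (partialExpansion {j : Fin n | (j : ℕ) < m} P)).height := by
    intro m
    induction m with
    | zero => intro _; simp
    | succ m ih =>
      intro hm
      obtain ⟨q, hq, hqP⟩ := hint ⟨m, hm⟩
      have hset : {j : Fin n | (j : ℕ) < m + 1} = insert ⟨m, hm⟩ {j : Fin n | (j : ℕ) < m} := by
        ext j
        simp [Fin.ext_iff]
        lia
      rw [hset]
      have hlt := Ideal.height_strict_mono_of_isPrime_of_isPrime
        (ker_partialExpansion_lt_insert (S := {j : Fin n | (j : ℕ) < m}) (i := ⟨m, hm⟩) h0 hP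
          (by simp) hq hqP)
      push_cast
      exact Order.add_one_le_of_lt ((ih (by lia)).trans_lt hlt)
  have hu : {j : Fin n | (j : ℕ) < n} = Set.univ := by ext j; simp
  have := key n le_rfl
  rwa [hu, ker_partialExpansion_univ] at this

theorem exists_generators_mod {K : Type*} [NontriviallyNormedField K] [IsUltrametricDist K]
    {ϖ : RingOfIntegers K}
    (hϖ : IsLocalRing.maximalIdeal (RingOfIntegers K) = Ideal.span {ϖ})
    {P : Ideal (IntegralTate K n)}
    (hfin : Module.Finite (ResField K)
      (MvPolynomial (Fin n) (ResField K) ⧸ P.map (reduction K n))) :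
    ∃ (s : ℕ) (e : Fin s → IntegralTate K n), ∀ f, ∃ (c : Fin s → RingOfIntegers K)
      (y : IntegralTate K n), f - (∑ j, const K n (c j) * e j + const K n ϖ * y) ∈ P := by
  have h0 := uniformizer_ne_zero hϖ
  obtain ⟨s, ebar, hebar⟩ := Module.Finite.exists_fin (R := ResField K)
    (M := MvPolynomial (Fin n) (ResField K) ⧸ P.map (reduction K n))
  have hsurj : Function.Surjective
      ((Ideal.Quotient.mk (P.map (reduction K n))).comp (reduction K n)) :=
    Ideal.Quotient.mk_surjective.comp reduction_surjective
  choose e he using fun j => hsurj (ebar j)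
  refine ⟨s, e, fun f => ?_⟩
  have hf : Ideal.Quotient.mk (P.map (reduction K n)) (reduction K n f) ∈
      Submodule.span (ResField K) (Set.range ebar) := hebar ▸ Submodule.mem_top
  obtain ⟨cbar, hcbar⟩ := (Submodule.mem_span_range_iff_exists_fun _).1 hf
  choose c hc using fun j => IsLocalRing.residue_surjective (cbar j)
  have h1 : reduction K n (f - ∑ j, const K n (c j) * e j) ∈ P.map (reduction K n) := by
    rw [← Ideal.Quotient.eq_zero_iff_mem, map_sub, map_sub, ← hcbar, sub_eq_zero, map_sum,
      map_sum]
    refine Finset.sum_congr rfl fun j _ => ?_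
    rw [map_mul, reduction_const, hc, ← he, MvPolynomial.C_mul']
    rfl
  obtain ⟨p, hpP, hp⟩ := (Ideal.mem_map_iff_of_surjective _ reduction_surjective).1 h1
  have h2 : f - ∑ j, const K n (c j) * e j - p ∈ RingHom.ker (reduction K n) := by
    rw [RingHom.mem_ker, map_sub, hp, sub_self]
  rw [ker_reduction hϖ h0, Ideal.mem_span_singleton] at h2
  obtain ⟨y, hy⟩ := h2
  refine ⟨c, y, ?_⟩
  rw [← hy]
  convert hpP using 1
  ring

end Strassmann

end

/-! ### Primes maximal among those avoiding the uniformizer, and the upper bound for heights -/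

noncomputable section

namespace Strassmann

open MvPowerSeries

variable {K : Type*} [NontriviallyNormedField K] [IsUltrametricDist K] [CompleteSpace K] {n : ℕ}
  {ϖ : RingOfIntegers K}

theorem span_const_le_jacobson
    (hϖ : IsLocalRing.maximalIdeal (RingOfIntegers K) = Ideal.span {ϖ}) :
    Ideal.span {const K n ϖ} ≤ (⊥ : Ideal (IntegralTate K n)).jacobson := by
  have := isAdicComplete_integralTate (n := n) (norm_uniformizer_lt_one hϖ) (uniformizer_ne_zero hϖ)
  exact IsAdicComplete.le_jacobson_bot _

theorem const_mem_of_isMaximal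
    (hϖ : IsLocalRing.maximalIdeal (RingOfIntegers K) = Ideal.span {ϖ})
    {M : Ideal (IntegralTate K n)} (hM : M.IsMaximal) : const K n ϖ ∈ M :=
  (sInf_le ⟨bot_le, hM⟩ : (⊥ : Ideal (IntegralTate K n)).jacobson ≤ M)
    (span_const_le_jacobson hϖ (Ideal.mem_span_singleton_self _))

/-- Krull's intersection theorem: `R⟨x⟩` is Noetherian and `ϖ` is in its Jacobson radical, so its
quotients are `ϖ`-adically separated. -/
theorem eq_zero_of_forall_eq_pow_smul
    (hϖ : IsLocalRing.maximalIdeal (RingOfIntegers K) = Ideal.span {ϖ})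
    {P : Ideal (IntegralTate K n)} {x : IntegralTate K n ⧸ P}
    (hx : ∀ N : ℕ, ∃ y : IntegralTate K n ⧸ P, x = const K n ϖ ^ N • y) : x = 0 := by
  have := isNoetherianRing_integralTate (n := n) hϖ (uniformizer_ne_zero hϖ)
  have : IsHausdorff (Ideal.span {const K n ϖ}) (IntegralTate K n ⧸ P) :=
    IsHausdorff.of_le_jacobson _ _ (span_const_le_jacobson hϖ)
  exact IsHausdorff.eq_zero_of_forall_pow_smul (const K n ϖ) hx

theorem mem_of_forall_sub_pow_mul_mem
    (hϖ : IsLocalRing.maximalIdeal (RingOfIntegers K) = Ideal.span {ϖ})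
    {P : Ideal (IntegralTate K n)} (f : IntegralTate K n)
    (hf : ∀ N, ∃ y, f - const K n ϖ ^ N * y ∈ P) : f ∈ P := by
  rw [← Ideal.Quotient.eq_zero_iff_mem]
  refine eq_zero_of_forall_eq_pow_smul hϖ fun N => ?_
  obtain ⟨y, hy⟩ := hf N
  exact ⟨Ideal.Quotient.mk P y, Ideal.Quotient.eq.2 hy⟩

/-- Every non-zero prime of the domain `R⟨x⟩ ⧸ P` contains `ϖ`, so
`Ideal.IsPrime.isMaximal_of_forall_ne_bot_mem` applies there. -/
theorem isMaximal_of_const_mem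
    (hϖ : IsLocalRing.maximalIdeal (RingOfIntegers K) = Ideal.span {ϖ})
    {P : Ideal (IntegralTate K n)} [P.IsPrime] (hP : const K n ϖ ∉ P)
    (hmax : ∀ Q : Ideal (IntegralTate K n), Q.IsPrime → P < Q → const K n ϖ ∈ Q)
    {Q : Ideal (IntegralTate K n)} (hQ : Q.IsPrime) (hPQ : P ≤ Q) (hϖQ : const K n ϖ ∈ Q) :
    Q.IsMaximal := by
  have := isNoetherianRing_integralTate (n := n) hϖ (uniformizer_ne_zero hϖ)
  have hsurj := Ideal.Quotient.mk_surjective (I := P)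
  have hcomap : (Q.map (Ideal.Quotient.mk P)).comap (Ideal.Quotient.mk P) = Q := by
    rw [Ideal.comap_map_of_surjective _ hsurj, ← RingHom.ker_eq_comap_bot, Ideal.mk_ker,
      sup_eq_left.2 hPQ]
  have hQ' : (Q.map (Ideal.Quotient.mk P)).IsPrime :=
    Ideal.map_isPrime_of_surjective hsurj (by rwa [Ideal.mk_ker])
  have := Ideal.IsPrime.isMaximal_of_forall_ne_bot_mem (π := Ideal.Quotient.mk P (const K n ϖ))
    (by rwa [Ne, Ideal.Quotient.eq_zero_iff_mem]) (fun Q' hQ' hbot => by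
      have hlt : P < Q'.comap (Ideal.Quotient.mk P) := by
        refine lt_of_le_of_ne ?_ fun h => hbot ?_
        · exact Ideal.mk_ker.symm.trans_le (Ideal.ker_le_comap (Ideal.Quotient.mk P))
        · rw [← Ideal.map_comap_of_surjective _ hsurj Q', ← h, Ideal.map_quotient_self]
      exact hmax _ (hQ'.comap _) hlt) hQ' (Ideal.mem_map_of_mem _ hϖQ)
  rw [← hcomap]
  exact Ideal.comap_isMaximal_of_surjective _ hsurj

/-- If `P` is maximal among the primes not containing the uniformizer, then `k[x] ⧸ P̄` is
finite-dimensional. -/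
theorem finite_quotient_map_reduction
    (hϖ : IsLocalRing.maximalIdeal (RingOfIntegers K) = Ideal.span {ϖ})
    {P : Ideal (IntegralTate K n)} [P.IsPrime] (hP : const K n ϖ ∉ P)
    (hmax : ∀ Q : Ideal (IntegralTate K n), Q.IsPrime → P < Q → const K n ϖ ∈ Q) :
    Module.Finite (ResField K)
      (MvPolynomial (Fin n) (ResField K) ⧸ P.map (reduction K n)) := by
  -- A finitely generated algebra over a field is finite-dimensional when all its primes are
  -- maximal. Here each prime pulls back to one containing both `P` and `ϖ`.
  rw [Module.finite_iff_isArtinianRing, isArtinianRing_iff_krullDimLE_zero]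
  refine Ring.KrullDimLE.mk₀ fun J hJ => ?_
  set g := (Ideal.Quotient.mk (P.map (reduction K n))).comp (reduction K n) with hg
  have hsurj : Function.Surjective g := Ideal.Quotient.mk_surjective.comp reduction_surjective
  have hJ' : (J.comap g).IsMaximal := by
    refine isMaximal_of_const_mem hϖ hP hmax (hJ.comap g) (fun f hf => ?_) ?_
    · rw [Ideal.mem_comap, hg, RingHom.comp_apply,
        Ideal.Quotient.eq_zero_iff_mem.2 (Ideal.mem_map_of_mem _ hf)]
      exact J.zero_mem
    · have : const K n ϖ ∈ RingHom.ker (reduction K n) := by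
        rw [ker_reduction hϖ (uniformizer_ne_zero hϖ)]
        exact Ideal.mem_span_singleton_self _
      rw [Ideal.mem_comap, hg, RingHom.comp_apply, RingHom.mem_ker.1 this, map_zero]
      exact J.zero_mem
  have := Ideal.map_eq_top_or_isMaximal_of_surjective g hsurj hJ'
  rw [Ideal.map_comap_of_surjective g hsurj] at this
  exact this.resolve_left hJ.ne_top

/-- If `P` is maximal among the primes not containing the uniformizer, then `R⟨x⟩ ⧸ P` is integral
over `R`. -/
theorem exists_monic_eval₂_mem
    (hϖ : IsLocalRing.maximalIdeal (RingOfIntegers K) = Ideal.span {ϖ})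
    {P : Ideal (IntegralTate K n)} [P.IsPrime] (hP : const K n ϖ ∉ P)
    (hmax : ∀ Q : Ideal (IntegralTate K n), Q.IsPrime → P < Q → const K n ϖ ∈ Q)
    (x : IntegralTate K n) :
    ∃ q : Polynomial (RingOfIntegers K), q.Monic ∧ q.eval₂ (const K n) x ∈ P := by
  obtain ⟨s, e, he⟩ := exists_generators_mod hϖ (finite_quotient_map_reduction hϖ hP hmax)
  have := isAdicComplete_ringOfIntegers (norm_uniformizer_lt_one hϖ) (uniformizer_ne_zero hϖ)
  let _ : Algebra (RingOfIntegers K) (IntegralTate K n ⧸ P) :=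
    ((Ideal.Quotient.mk P).comp (const K n)).toAlgebra
  have hsmul : ∀ (a : RingOfIntegers K) (f : IntegralTate K n),
      a • Ideal.Quotient.mk P f = Ideal.Quotient.mk P (const K n a * f) := fun a f => by
    rw [Algebra.smul_def, map_mul]; rfl
  -- Complete Nakayama: generators modulo `ϖ` generate, since `R` is complete and `R⟨x⟩ ⧸ P` is
  -- separated. Finite then implies integral.
  have : Module.Finite (RingOfIntegers K) (IntegralTate K n ⧸ P) := by
    refine Module.Finite.of_isPrecomplete_span_singleton ϖ (fun j => Ideal.Quotient.mk P (e j))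
      (fun z hz => eq_zero_of_forall_eq_pow_smul hϖ fun N => ?_) fun z => ?_
    · obtain ⟨y, rfl⟩ := hz N
      obtain ⟨f, rfl⟩ := Ideal.Quotient.mk_surjective y
      exact ⟨Ideal.Quotient.mk P f, by rw [hsmul, map_pow]; rfl⟩
    · obtain ⟨f, rfl⟩ := Ideal.Quotient.mk_surjective z
      obtain ⟨c, y, h⟩ := he f
      refine ⟨c, Ideal.Quotient.mk P y, ?_⟩
      simp only [hsmul]
      rw [← map_sum, ← map_add]
      exact Ideal.Quotient.eq.2 h
  obtain ⟨q, hq, hqx⟩ := Algebra.IsIntegral.isIntegral (R := RingOfIntegers K)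
    (Ideal.Quotient.mk P x)
  refine ⟨q, hq, ?_⟩
  rw [← Ideal.Quotient.eq_zero_iff_mem, ← hqx, Polynomial.hom_eval₂]
  rfl

/-- An ideal avoiding the powers of the uniformizer lies in a prime that is maximal among the
ideals not containing the uniformizer. -/
theorem exists_isPrime_maximal {A : Type*} [CommRing A] [IsNoetherianRing A] {p : A} {I : Ideal A}
    (hI : ∀ m, p ^ m ∉ I) : ∃ P : Ideal A, P.IsPrime ∧ I ≤ P ∧ p ∉ P ∧
      ∀ Q : Ideal A, Q.IsPrime → P < Q → p ∈ Q := by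
  -- A maximal element among the ideals containing `I` and avoiding all powers of `p` is
  -- automatically prime.
  obtain ⟨P, ⟨hIP, hP⟩, hmax⟩ := WellFounded.has_min
    (wellFounded_gt : WellFounded ((· > ·) : Ideal A → Ideal A → Prop))
    {J | I ≤ J ∧ ∀ m, p ^ m ∉ J} ⟨I, le_rfl, hI⟩
  refine ⟨P, ?_, hIP, fun h => hP 1 (by rwa [pow_one]), fun Q hQ hlt => ?_⟩
  · refine Ideal.isPrime_of_maximally_disjoint P (Submonoid.powers p) ?_ fun J hJ hdisj => ?_
    · rw [Set.disjoint_right]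
      rintro _ ⟨m, rfl⟩ h
      exact hP m h
    · exact hmax J ⟨hIP.trans hJ.le, fun m hm =>
        Set.disjoint_left.1 hdisj hm ⟨m, rfl⟩⟩ hJ
  · by_contra h
    exact hmax Q ⟨hIP.trans hlt.le, fun m hm => h (hQ.mem_of_pow_mem m hm)⟩ hlt

/-- A prime inside `P` avoids `ϖ`, so it contains `I_l` as soon as it contains `I`. Hence the `r`
generators of `I`, rather than those of `I_l`, together with lifts of `ht (P/I_l)` elements cut out
`P` as a minimal prime, and Krull's height theorem applies. -/
theorem height_le_height_map_add {r l : ℕ}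
    (hϖ : IsLocalRing.maximalIdeal (RingOfIntegers K) = Ideal.span {ϖ})
    {I P : Ideal (IntegralTate K n)} (hI : GeneratedBy I r) [P.IsPrime] (hIP : I ≤ P)
    (hP : const K n ϖ ∉ P) :
    P.height ≤ (P.map (Ideal.Quotient.mk (stepIdeal ϖ I l))).height + r := by
  classical
  have := isNoetherianRing_integralTate (n := n) hϖ (uniformizer_ne_zero hϖ)
  have hle : ∀ Q : Ideal (IntegralTate K n), Q.IsPrime → const K n ϖ ∉ Q → I ≤ Q →
      stepIdeal ϖ I l ≤ Q := fun Q hQ hϖQ hIQ g hg => by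
    have := hIQ (mem_stepIdeal.1 hg)
    rw [map_pow] at this
    exact (hQ.mem_or_mem this).resolve_left fun h => hϖQ (hQ.mem_of_pow_mem l h)
  have hsurj := Ideal.Quotient.mk_surjective (I := stepIdeal ϖ I l)
  have hcomap : ∀ Q : Ideal (IntegralTate K n), stepIdeal ϖ I l ≤ Q →
      (Q.map (Ideal.Quotient.mk (stepIdeal ϖ I l))).comap
        (Ideal.Quotient.mk (stepIdeal ϖ I l)) = Q := fun Q hQ => by
    rw [Ideal.comap_map_of_surjective _ hsurj, ← RingHom.ker_eq_comap_bot, Ideal.mk_ker,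
      sup_eq_left.2 hQ]
  have hlP := hle P inferInstance hP hIP
  have hP' : (P.map (Ideal.Quotient.mk (stepIdeal ϖ I l))).IsPrime :=
    Ideal.map_isPrime_of_surjective hsurj (by rwa [Ideal.mk_ker])
  obtain ⟨s, hs, hcard⟩ := Ideal.exists_finset_card_eq_height_of_isNoetherianRing
    (P.map (Ideal.Quotient.mk (stepIdeal ϖ I l)))
  obtain ⟨F, rfl⟩ := hI
  set lift := Function.surjInv hsurj
  have hlift : ∀ y, Ideal.Quotient.mk _ (lift y) = y := Function.surjInv_eq hsurj
  have hmin : P ∈ (Ideal.span ((Finset.univ.image F ∪ s.image lift : Finset (IntegralTate K n)) :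
      Set (IntegralTate K n))).minimalPrimes := by
    refine ⟨⟨inferInstance, ?_⟩, ?_⟩
    · rw [Ideal.span_le]
      intro x hx
      rw [Finset.mem_coe, Finset.mem_union, Finset.mem_image, Finset.mem_image] at hx
      rcases hx with ⟨i, -, rfl⟩ | ⟨y, hy, rfl⟩
      · exact hIP (Ideal.subset_span ⟨i, rfl⟩)
      · rw [SetLike.mem_coe, ← hcomap P hlP, Ideal.mem_comap, hlift]
        exact hs.1.2 (Ideal.subset_span hy)
    · rintro Q ⟨hQ, hsQ⟩ hQP
      rw [Ideal.span_le] at hsQ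
      have hlQ := hle Q hQ (fun h => hP (hQP h)) (Ideal.span_le.2 (by
        rintro _ ⟨i, rfl⟩
        exact hsQ (by simp)))
      have hQ' : (Q.map (Ideal.Quotient.mk
          (stepIdeal ϖ (Ideal.span (Set.range F)) l))).IsPrime :=
        Ideal.map_isPrime_of_surjective hsurj (by rwa [Ideal.mk_ker])
      have := hs.2 ⟨hQ', Ideal.span_le.2 fun y hy => by
        have hly : lift y ∈ Q := hsQ (by
          rw [Finset.mem_coe, Finset.mem_union]
          exact Or.inr (Finset.mem_image_of_mem _ hy))
        rw [← hlift y]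
        exact Ideal.mem_map_of_mem _ hly⟩ (Ideal.map_mono hQP)
      rw [← hcomap P hlP, ← hcomap Q hlQ]
      exact Ideal.comap_mono this
  refine (Ideal.height_le_card_of_mem_minimalPrimes_span_finset hmin).trans ?_
  rw [← hcard, add_comm]
  have h1 := Finset.card_union_le (Finset.univ.image F) (s.image lift)
  have h2 : (Finset.univ.image F).card ≤ r := Finset.card_image_le.trans (by simp)
  have h3 : (s.image lift).card ≤ s.card := Finset.card_image_le
  exact_mod_cast h1.trans (add_le_add h2 h3)

/-- A maximal `M ⊇ P` contains `ϖ`, so modulo `J` its height exceeds that of `P`. That height is at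
most `1` plus the dimension of `R⟨x⟩/(J, ϖ) = k[x]/J̄`, and the two units cancel. -/
theorem height_map_le_dimReduction
    (hϖ : IsLocalRing.maximalIdeal (RingOfIntegers K) = Ideal.span {ϖ})
    {J P : Ideal (IntegralTate K n)} [P.IsPrime] (hJP : J ≤ P) (hP : const K n ϖ ∉ P) :
    ((P.map (Ideal.Quotient.mk J)).height : WithBot ℕ∞) ≤ dimReduction J := by
  have h0 := uniformizer_ne_zero hϖ
  have := isNoetherianRing_integralTate (n := n) hϖ h0
  have hsurj := Ideal.Quotient.mk_surjective (I := J)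
  obtain ⟨M, hM, hPM⟩ := Ideal.exists_le_maximal P Ideal.IsPrime.ne_top'
  have hpM := const_mem_of_isMaximal hϖ hM
  have hMprime := hM.isPrime
  have hP' : (P.map (Ideal.Quotient.mk J)).IsPrime :=
    Ideal.map_isPrime_of_surjective hsurj (by rwa [Ideal.mk_ker])
  have hM' : (M.map (Ideal.Quotient.mk J)).IsPrime :=
    Ideal.map_isPrime_of_surjective hsurj (by rw [Ideal.mk_ker]; exact hJP.trans hPM)
  have hlt : P.map (Ideal.Quotient.mk J) < M.map (Ideal.Quotient.mk J) := by
    refine lt_of_le_not_ge (Ideal.map_mono hPM) fun hle => hP ?_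
    have := hle (Ideal.mem_map_of_mem _ hpM)
    rw [← Ideal.mem_comap, Ideal.comap_map_of_surjective _ hsurj, ← RingHom.ker_eq_comap_bot,
      Ideal.mk_ker, sup_eq_left.2 hJP] at this
    exact this
  have h1 : (P.map (Ideal.Quotient.mk J)).height + 1 ≤ (M.map (Ideal.Quotient.mk J)).height :=
    Order.add_one_le_of_lt (Ideal.height_strict_mono_of_isPrime_of_isPrime hlt)
  have h2 := Ideal.height_le_ringKrullDim_quotient_add_one (Ideal.mem_map_of_mem
    (Ideal.Quotient.mk J) hpM)
  let e : ((IntegralTate K n ⧸ J) ⧸ Ideal.span {Ideal.Quotient.mk J (const K n ϖ)}) ≃+*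
      (MvPolynomial (Fin n) (ResField K) ⧸ reducedIdeal J) :=
    (Ideal.quotEquivOfEq (by rw [Ideal.map_span, Set.image_singleton])).trans
      ((DoubleQuot.quotQuotEquivQuotSup J (Ideal.span {const K n ϖ})).trans
        ((Ideal.quotEquivOfEq (by
          rw [← RingHom.comap_ker, Ideal.mk_ker, reducedIdeal,
            Ideal.comap_map_of_surjective _ reduction_surjective, ← RingHom.ker_eq_comap_bot,
            ker_reduction hϖ h0])).trans
        (RingHom.quotientKerEquivOfSurjective
          (f := (Ideal.Quotient.mk (reducedIdeal J)).comp (reduction K n))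
          (Ideal.Quotient.mk_surjective.comp reduction_surjective))))
  rw [ringKrullDim_eq_of_ringEquiv e] at h2
  have h3 := (WithBot.coe_le_coe.2 h1).trans h2
  change _ ≤ dimReduction J + 1 at h3
  generalize dimReduction J = d at h3
  induction d with
  | bot => exact absurd h3 (by rw [WithBot.bot_add]; exact WithBot.not_coe_le_bot _)
  | coe d =>
    have h4 : (P.map (Ideal.Quotient.mk J)).height + 1 ≤ d + 1 := by exact_mod_cast h3
    exact WithBot.coe_le_coe.2 ((ENat.add_le_add_iff_right ENat.one_ne_top).1 h4)

theorem saturation_eq_top {r l : ℕ}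
    (hϖ : IsLocalRing.maximalIdeal (RingOfIntegers K) = Ideal.span {ϖ})
    {I : Ideal (IntegralTate K n)} (hI : GeneratedBy I r)
    (hdim : dimReduction (stepIdeal ϖ I l) + (r : WithBot ℕ∞) < (n : WithBot ℕ∞)) :
    saturation I = ⊤ := by
  have h0 := uniformizer_ne_zero hϖ
  have := isNoetherianRing_integralTate (n := n) hϖ h0
  by_contra hne
  obtain ⟨P, hP, hIP, hϖP, hmax⟩ := exists_isPrime_maximal (p := const K n ϖ) (I := I) fun m hm =>
    hne ((Ideal.eq_top_iff_one _).2 ((mem_saturation_iff (norm_uniformizer_lt_one hϖ) h0).2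
      ⟨m, by rwa [mul_one]⟩))
  have h1 : (n : ℕ∞) ≤ P.height := natCast_le_height h0
    (mem_of_forall_sub_pow_mul_mem hϖ) fun i => exists_monic_eval₂_mem hϖ hϖP hmax (var K i)
  have h2 := h1.trans (height_le_height_map_add (l := l) hϖ hI hIP hϖP)
  have hlP : stepIdeal ϖ I l ≤ P := fun g hg => by
    have := hIP (mem_stepIdeal.1 hg)
    rw [map_pow] at this
    exact (hP.mem_or_mem this).resolve_left fun h => hϖP (hP.mem_of_pow_mem l h)
  have h3 := height_map_le_dimReduction hϖ hlP hϖP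
  -- Chain of estimates: `n ≤ ht P ≤ ht (P/I_l) + r ≤ dim k[x]/Ī_l + r`.
  refine hdim.not_ge (le_trans ?_ (add_le_add_left h3 _))
  exact_mod_cast h2

end Strassmann

end

theorem mainTheorem4 {K : Type*} [NontriviallyNormedField K] [IsUltrametricDist K]
    [CompleteSpace K] (ϖ : Strassmann.RingOfIntegers K)
    (hϖ : IsLocalRing.maximalIdeal (Strassmann.RingOfIntegers K) = Ideal.span {ϖ})
    (n r : ℕ) (I : Ideal (Strassmann.IntegralTate K n)) (hI : Strassmann.GeneratedBy I r) :
    (∀ l : ℕ, Strassmann.dimReduction (Strassmann.stepIdeal ϖ I l) + (r : WithBot ℕ∞)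
        < (n : WithBot ℕ∞) → Strassmann.saturation I = ⊤) ∧
    (∀ l : ℕ, Strassmann.dimReduction (Strassmann.stepIdeal ϖ I l) + (r : WithBot ℕ∞)
        = (n : WithBot ℕ∞) → Strassmann.GeneratedBy (Strassmann.stepIdeal ϖ I l) r →
        Strassmann.stepIdeal ϖ I l = Strassmann.saturation I) ∧
    (Strassmann.dimReduction I + (r : WithBot ℕ∞) = (n : WithBot ℕ∞) →
        I = Strassmann.saturation I) := by
  have h0 := Strassmann.uniformizer_ne_zero hϖ
  refine ⟨fun l hl => Strassmann.saturation_eq_top hϖ hI hl,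
    fun l hl hIl => Strassmann.stepIdeal_eq_saturation hϖ h0 hIl hl, fun h => ?_⟩
  have hstep : Strassmann.stepIdeal ϖ I 0 = I := by
    ext g
    rw [Strassmann.mem_stepIdeal, pow_zero, map_one, one_mul]
  have := Strassmann.stepIdeal_eq_saturation (l := 0) hϖ h0 (by rwa [hstep]) (by rwa [hstep])
  rwa [hstep] at this
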